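/- Let $\mathbb{Q}\mathbb{U}$ be the rational Urysohn metric space, i.e. the (up to isometry unique) countable metric space with rational distances such that, whenever $Y=X\cup\{y\}$ is a finite metric space with rational distances, every isometric embedding $X\to\mathbb{Q}\mathbb{U}$ extends to an isometric embedding $Y\to\mathbb{Q}\mathbb{U}$. Give $G={\rm Isom}(\mathbb{Q}\mathbb{U})$, the group of isometries of $\mathbb{Q}\mathbb{U}$ onto itself, the topology with basic open sets $\{g\in G : g(x_i)=f(x_i),\ i\le n\}$, where $f\in G$ and $x_1,\dots,x_n\in\mathbb{Q}\mathbb{U}$. For a countable group $\Lambda$, let ${\rm Rep}(\Lambda,G)\subseteq G^\Lambda$ be the space of homomorphisms $\Lambda\to G$ (equivalently, of isometric actions of $\Lambda$ on $\mathbb{Q}\mathbb{U}$) with the subspace topology of the product. Such a homomorphism $\pi$ is *generic* if its orbit $\{g\pi g^{-1} : g\in G\}$ under conjugation is comeagre in ${\rm Rep}(\Lambda,G)$. A group $\Gamma$ has *property (RZ)* if every product $H_1H_2\cdots H_n$ of finitely generated subgroups $H_i\leqslant\Gamma$ is closed in the profinite topology of $\Gamma$, the topology generated by the cosets of the finite index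 normal subgroups. **Theorem.** Let $\Gamma$ be a countable group that is the union of an increasing sequence $\Delta_0\leqslant\Delta_1\leqslant\cdots$ of finitely generated subgroups, each of which has property (RZ). Then there is a homomorphism $\pi\colon\Gamma\to{\rm Isom}(\mathbb{Q}\mathbb{U})$ such that for every finitely generated subgroup $\Lambda\leqslant\Gamma$ the restriction $\pi|_\Lambda$ is generic. The hypothesis on $\Gamma$ holds for every countable group that itself has property (RZ), and for the additive group $\mathbb{Q}$. -/

import Mathlib

open scoped Pointwise

noncomputable section

/-! The rational Urysohn metric space. -/

/-- The characterisation of the rational Urysohn space (unique up to isometry): a countable metric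
space with rational distances such that, for every finite metric space `Y = X ∪ {y}` with rational
distances, each isometric embedding of `X` extends to an isometric embedding of `Y`. -/
structure IsRationalUrysohn (U : Type*) [MetricSpace U] : Prop where
  countable : Countable U
  rational : ∀ u v : U, ∃ q : ℚ, dist u v = q
  extension : ∀ (Y : Type) [MetricSpace Y] [Finite Y], (∀ a b : Y, ∃ q : ℚ, dist a b = q) →
    ∀ (y : Y) (φ : {x : Y // x ≠ y} → U), Isometry φ →
      ∃ ψ : Y → U, Isometry ψ ∧ ∀ x : {x : Y // x ≠ y}, ψ x = φ x

namespace RationalUrysohn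

/-- `d` is a rational-valued pseudometric on `ℕ`. -/
structure IsPseudometric (d : ℕ → ℕ → ℚ) : Prop where
  self : ∀ i, d i i = 0
  symm : ∀ i j, d i j = d j i
  tri : ∀ i j k, d i k ≤ d i j + d j k

/-- `f` is a Katetov function: a possible distance function of one further point. -/
def IsKatetov (d : ℕ → ℕ → ℚ) (f : ℕ → ℚ) : Prop :=
  ∀ i j, f i ≤ d i j + f j ∧ d i j ≤ f i + f j

/-- The finite sets of prescribed distances `(i, r)`; each of them occurs infinitely often. -/
def task (n : ℕ) : Finset (ℕ × ℚ) := (Encodable.decode (Nat.unpair n).1).getD ∅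

open Classical in
/-- A Katetov function taking the prescribed values, if there is one. -/
def pick (d : ℕ → ℕ → ℚ) (n : ℕ) (S : Finset (ℕ × ℚ)) : ℕ → ℚ :=
  if h : ∃ f, IsKatetov d f ∧ ∀ p ∈ S, f p.1 = p.2 then h.choose else d n

/-- Redefine the distances from the point `n` to be given by `f`. -/
def replace (d : ℕ → ℕ → ℚ) (n : ℕ) (f : ℕ → ℚ) (i j : ℕ) : ℚ :=
  if i = n then (if j = n then 0 else f j) else if j = n then f i else d i j

/-- The approximations: the `n`-th step fixes the distances from `n` to all smaller points. -/
def stage : ℕ → ℕ → ℕ → ℚ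
  | 0 => fun _ _ => 0
  | n + 1 => replace (stage n) n (pick (stage n) n (task n))

/-- The limit pseudometric on `ℕ`. -/
def qdist (i j : ℕ) : ℚ := stage (max i j + 1) i j

theorem IsPseudometric.nonneg {d : ℕ → ℕ → ℚ} (h : IsPseudometric d) (i j : ℕ) : 0 ≤ d i j := by
  have h1 := h.tri i j i
  rw [h.self, h.symm j i] at h1
  linarith

theorem pick_isKatetov {d : ℕ → ℕ → ℚ} (h : IsPseudometric d) (n : ℕ) (S : Finset (ℕ × ℚ)) :
    IsKatetov d (pick d n S) := by
  unfold pick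
  split_ifs with hS
  · exact hS.choose_spec.1
  · intro i j
    have h1 := h.tri n j i
    have h2 := h.tri i n j
    have h3 := h.symm j i
    have h4 := h.symm i n
    constructor <;> linarith

theorem pick_eq {d : ℕ → ℕ → ℚ} {n : ℕ} {S : Finset (ℕ × ℚ)}
    (hS : ∃ f, IsKatetov d f ∧ ∀ p ∈ S, f p.1 = p.2) : ∀ p ∈ S, pick d n S p.1 = p.2 := by
  unfold pick
  rw [dif_pos hS]
  exact hS.choose_spec.2

theorem replace_isPseudometric {d : ℕ → ℕ → ℚ} (h : IsPseudometric d) (n : ℕ) {f : ℕ → ℚ}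
    (hf : IsKatetov d f) : IsPseudometric (replace d n f) := by
  have f0 : ∀ i, 0 ≤ f i := fun i => by
    have := (hf i i).2
    rw [h.self] at this
    linarith
  refine ⟨fun i => ?_, fun i j => ?_, fun i j k => ?_⟩
  · unfold replace
    split_ifs
    · rfl
    · exact h.self i
  · unfold replace
    split_ifs <;> first | rfl | exact h.symm i j
  · have a1 := f0 i
    have a2 := f0 j
    have a3 := f0 k
    have a4 := hf i j
    have a5 := hf j k
    have a6 := hf i k
    have a7 := hf k j
    have a8 := h.symm j k
    have a9 := h.tri i j k
    unfold replace
    split_ifs <;> linarith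

theorem stage_isPseudometric (n : ℕ) : IsPseudometric (stage n) := by
  induction n with
  | zero => exact ⟨fun _ => rfl, fun _ _ => rfl, fun _ _ _ => by simp [stage]⟩
  | succ n ih => exact replace_isPseudometric ih n (pick_isKatetov ih n _)

theorem stage_eq {i j : ℕ} (k : ℕ) (hi : i < k) (hj : j < k) : stage k i j = qdist i j := by
  have key : ∀ m, stage (max i j + 1 + m) i j = qdist i j := by
    intro m
    induction m with
    | zero => rfl
    | succ m ih =>
      rw [← ih, ← add_assoc]
      have h1 : i ≠ max i j + 1 + m := by omega
      have h2 : j ≠ max i j + 1 + m := by omega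
      simp only [stage, replace, if_neg h1, if_neg h2]
  obtain ⟨m, rfl⟩ : ∃ m, k = max i j + 1 + m := ⟨k - (max i j + 1), by omega⟩
  exact key m

theorem qdist_isPseudometric : IsPseudometric qdist := by
  refine ⟨fun i => (stage_isPseudometric _).self i, fun i j => ?_, fun i j k => ?_⟩
  · rw [← stage_eq (max i j + 1) (by omega) (by omega),
      ← stage_eq (i := j) (max i j + 1) (by omega) (by omega)]
    exact (stage_isPseudometric _).symm i j
  · rw [← stage_eq (i := i) (j := k) (i + j + k + 1) (by omega) (by omega),
      ← stage_eq (i := i) (j := j) (i + j + k + 1) (by omega) (by omega),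
      ← stage_eq (i := j) (j := k) (i + j + k + 1) (by omega) (by omega)]
    exact (stage_isPseudometric _).tri i j k

theorem exists_katetov {d : ℕ → ℕ → ℚ} (h : IsPseudometric d) {ι : Type} [Finite ι]
    (a : ι → ℕ) (r : ι → ℚ)
    (hr : ∀ x y, r x ≤ d (a x) (a y) + r y ∧ d (a x) (a y) ≤ r x + r y) :
    ∃ f, IsKatetov d f ∧ ∀ x, f (a x) = r x := by
  cases nonempty_fintype ι
  rcases isEmpty_or_nonempty ι with hι | hι
  · refine ⟨d 0, fun i j => ?_, fun x => hι.elim x⟩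
    have h1 := h.tri 0 j i
    have h2 := h.tri i 0 j
    have h3 := h.symm j i
    have h4 := h.symm i 0
    constructor <;> linarith
  · let f : ℕ → ℚ := fun j =>
      Finset.univ.inf' Finset.univ_nonempty (fun x : ι => r x + d (a x) j)
    have fle : ∀ j x, f j ≤ r x + d (a x) j := fun j x =>
      Finset.inf'_le (fun x : ι => r x + d (a x) j) (Finset.mem_univ x)
    have fex : ∀ j, ∃ x, f j = r x + d (a x) j := fun j => by
      obtain ⟨x, -, hx⟩ := Finset.exists_mem_eq_inf' (s := (Finset.univ : Finset ι))
        Finset.univ_nonempty (fun x : ι => r x + d (a x) j)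
      exact ⟨x, hx⟩
    refine ⟨f, fun i j => ?_, fun x => ?_⟩
    · obtain ⟨x, hx⟩ := fex i
      obtain ⟨y, hy⟩ := fex j
      have h1 := fle i y
      have h2 := h.tri (a y) j i
      have h3 := h.symm j i
      have h4 := h.tri i (a x) j
      have h5 := h.tri (a x) (a y) j
      have h6 := (hr x y).2
      have h7 := h.symm i (a x)
      constructor <;> linarith
    · obtain ⟨y, hy⟩ := fex (a x)
      have h1 := fle (a x) x
      have h2 := (hr x y).1
      rw [h.self] at h1
      rw [h.symm] at h2
      linarith

theorem exists_point {ι : Type} [Finite ι] (a : ι → ℕ) (r : ι → ℚ)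
    (hr : ∀ x y, r x ≤ qdist (a x) (a y) + r y ∧ qdist (a x) (a y) ≤ r x + r y) :
    ∃ n, ∀ x, qdist n (a x) = r x := by
  classical
  cases nonempty_fintype ι
  obtain ⟨m, hm⟩ : ∃ m, ∀ x, a x < m :=
    ⟨Finset.univ.sup a + 1, fun x => Nat.lt_succ_of_le (Finset.le_sup (Finset.mem_univ x))⟩
  let S : Finset (ℕ × ℚ) := Finset.univ.image fun x => (a x, r x)
  let n := Nat.pair (Encodable.encode S) m
  have hn : ∀ x, a x < n := fun x => lt_of_lt_of_le (hm x) (Nat.right_le_pair _ _)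
  have ht : task n = S := by simp [task, n]
  have hex : ∃ f, IsKatetov (stage n) f ∧ ∀ p ∈ S, f p.1 = p.2 := by
    obtain ⟨f, hf, hfa⟩ := exists_katetov (stage_isPseudometric n) a r (fun x y => by
      rw [stage_eq n (hn x) (hn y)]
      exact hr x y)
    refine ⟨f, hf, fun p hp => ?_⟩
    obtain ⟨x, -, rfl⟩ := Finset.mem_image.1 hp
    exact hfa x
  refine ⟨n, fun x => ?_⟩
  have h1 : a x ≠ n := (hn x).ne
  rw [← stage_eq (n + 1) (Nat.lt_succ_self n) (Nat.lt_succ_of_lt (hn x))]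
  simp only [stage, replace, if_neg h1, if_true, ht]
  exact pick_eq hex (a x, r x) (Finset.mem_image_of_mem _ (Finset.mem_univ x))

/-- A copy of `ℕ`, carrying the limit pseudometric. -/
def Pre : Type := ℕ

instance : PseudoMetricSpace Pre where
  dist i j := ((qdist i j : ℚ) : ℝ)
  dist_self i := by exact_mod_cast qdist_isPseudometric.self i
  dist_comm i j := by exact_mod_cast qdist_isPseudometric.symm i j
  dist_triangle i j k := by exact_mod_cast qdist_isPseudometric.tri i j k

end RationalUrysohn

/-- The rational Urysohn space: the metric quotient of `ℕ` with the pseudometric built above. -/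
def RationalUrysohn : Type := SeparationQuotient RationalUrysohn.Pre

instance : MetricSpace RationalUrysohn :=
  inferInstanceAs (MetricSpace (SeparationQuotient RationalUrysohn.Pre))

namespace RationalUrysohn

/-- The point of the rational Urysohn space named by a natural number. -/
def pt (n : ℕ) : RationalUrysohn := SeparationQuotient.mk (X := Pre) n

theorem dist_pt (i j : ℕ) : dist (pt i) (pt j) = (qdist i j : ℝ) := rfl

theorem pt_surjective : Function.Surjective pt := SeparationQuotient.surjective_mk (X := Pre)

theorem isRationalUrysohn : IsRationalUrysohn RationalUrysohn where
  countable := pt_surjective.countable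
  rational u v := by
    obtain ⟨i, rfl⟩ := pt_surjective u
    obtain ⟨j, rfl⟩ := pt_surjective v
    exact ⟨qdist i j, dist_pt i j⟩
  extension Y _ _ hY y φ hφ := by
    classical
    choose a ha using fun x => pt_surjective (φ x)
    choose q hq using hY
    have hd : ∀ x x' : {x : Y // x ≠ y}, dist (x : Y) x' = (qdist (a x) (a x') : ℝ) := fun x x' => by
      rw [← dist_pt, ha, ha, hφ.dist_eq]
      rfl
    obtain ⟨n, hn⟩ := exists_point a (fun x => q x y) (fun x x' => by
      have h1 := dist_triangle (x : Y) x' y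
      have h2 := dist_triangle (x : Y) y x'
      rw [dist_comm y (x' : Y)] at h2
      rw [hd, hq, hq] at h1 h2
      exact ⟨by exact_mod_cast h1, by exact_mod_cast h2⟩)
    have hny : ∀ x : {x : Y // x ≠ y}, dist (pt n) (φ x) = dist (x : Y) y := fun x => by
      rw [← ha, dist_pt, hn, hq]
    refine ⟨fun x => if h : x = y then pt n else φ ⟨x, h⟩, ?_, fun x => dif_neg x.2⟩
    refine Isometry.of_dist_eq fun x x' => ?_
    by_cases h : x = y <;> by_cases h' : x' = y
    · simp [h, h']
    · simp only [dif_pos h, dif_neg h', hny]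
      rw [h, dist_comm]
    · simp only [dif_neg h, dif_pos h', dist_comm _ (pt n), hny]
      rw [h']
    · simp only [dif_neg h, dif_neg h', hφ.dist_eq]
      rfl

/-- The permutation group topology on `Isom(ℚ𝕌)`: pointwise convergence, the space being
discrete. -/
instance : TopologicalSpace (RationalUrysohn ≃ᵢ RationalUrysohn) :=
  TopologicalSpace.induced (fun f (x : RationalUrysohn) => f x)
    (@Pi.topologicalSpace RationalUrysohn (fun _ => RationalUrysohn) (fun _ => ⊥))

end RationalUrysohn

/-! Representations. -/

/-- The topology on the space `Rep(Γ, G)` of homomorphisms, as a subspace of `G ^ Γ`. -/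
@[reducible] def repTopology (Γ G : Type*) [Group Γ] [Group G] [TopologicalSpace G] :
    TopologicalSpace (Γ →* G) :=
  TopologicalSpace.induced (fun π (γ : Γ) => π γ) Pi.topologicalSpace

/-- The orbit of `π` under the conjugation action of `G`, `(g · π)(γ) = g π(γ) g⁻¹`. -/
def conjOrbit {Γ G : Type*} [Group Γ] [Group G] (π : Γ →* G) : Set (Γ →* G) :=
  {σ | ∃ g : G, ∀ γ : Γ, σ γ = g * π γ * g⁻¹}

/-- A representation is generic if its orbit is comeagre in `Rep(Γ, G)`. -/
def IsGeneric {Γ G : Type*} [Group Γ] [Group G] [TopologicalSpace G] (π : Γ →* G) : Prop :=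
  conjOrbit π ∈ @residual (Γ →* G) (repTopology Γ G)

/-! The Ribes-Zalesskii property. -/

/-- The profinite topology, generated by the cosets of finite index normal subgroups. -/
@[reducible] def profiniteTopology (Γ : Type*) [Group Γ] : TopologicalSpace Γ :=
  TopologicalSpace.generateFrom
    {S | ∃ (g : Γ) (K : Subgroup Γ), K.Normal ∧ K.FiniteIndex ∧ S = g • (K : Set Γ)}

/-- Property (RZ): every product `H₁ H₂ ⋯ Hₙ` of finitely generated subgroups is closed in the
profinite topology. -/
def HasRZ (Γ : Type*) [Group Γ] : Prop :=
  ∀ L : List (Subgroup Γ), (∀ H ∈ L, H.FG) →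
    @IsClosed Γ (profiniteTopology Γ) (L.map fun H => (H : Set Γ)).prod

/-- `Γ` is the union of an increasing sequence of finitely generated subgroups with (RZ). -/
def IsIncreasingUnionRZ (Γ : Type*) [Group Γ] : Prop :=
  ∃ Δ : ℕ → Subgroup Γ, Monotone Δ ∧ (∀ n, (Δ n).FG) ∧ (∀ n, HasRZ (Δ n)) ∧
    ∀ γ : Γ, ∃ n, γ ∈ Δ n

end

open scoped Topology Filter

/-! For a finitely generated group `L`, call an action on ℚ𝕌 universal (`IsUniversalAction`) if it
has a fixed point, all its orbits are finite, and every finite `L`-space extending a finite nonempty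
invariant subspace of ℚ𝕌 is realised over that subspace. Two universal actions are conjugate
(`IsUniversalAction.mem_conjOrbit`): match fixed points and go back and forth equivariantly, adding
a finite orbit at each step.

It then suffices that, for `f : L →* Γ` injective, the `π` with `π.comp f` universal form a comeagre
set (`eventually_isUniversalAction`). Finite generation makes each of countably many conditions
open. Density rests on two constructions. Realising extensions uses amalgamation of a `Γ`-space with
the space induced from an `L`-space (`exists_amalgam`), followed by an equivariant embedding into ℚ𝕌
(`exists_equivariant_embedding`). Making orbits finite uses (RZ): a finite piece of an action is the
quotient of a weighted graph on copies of the piece. The endpoints of short paths form finite unions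
of translated products of finitely generated subgroups, hence closed sets, so some finite index
subgroup avoids the shortcuts that would shrink distances (`HasRZ.exists_finite_approximation`).

There are countably many finitely generated `Λ ≤ Γ`, so by Baire category some `π` is universal on
all of them. Each `Λ` lies in some `Δ n` and so has (RZ) itself; hence universal actions are
comeagre in the representations of `Λ`, and they all lie in one conjugacy class. -/

/-! ### Rational pseudometrics and equivariant amalgamation. -/

/-- A pseudometric with rational values. -/
structure IsRatPseudometric {X : Type*} (d : X → X → ℚ) : Prop where
  self : ∀ x, d x x = 0
  symm : ∀ x y, d x y = d y x
  tri : ∀ x y z, d x z ≤ d x y + d y z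

theorem IsRatPseudometric.nonneg {X : Type*} {d : X → X → ℚ} (h : IsRatPseudometric d) (x y : X) :
    0 ≤ d x y := by
  have h1 := h.tri x y x
  rw [h.self, h.symm y x] at h1
  linarith

theorem IsRatPseudometric.comap {X Y : Type*} {d : X → X → ℚ} (h : IsRatPseudometric d)
    (f : Y → X) : IsRatPseudometric fun x y => d (f x) (f y) :=
  ⟨fun _ => h.self _, fun _ _ => h.symm _ _, fun _ _ _ => h.tri _ _ _⟩

/-- A family of copies of `Y` indexed by `Γ`, on which `Γ` acts by permuting the copies. -/
structure Copies (Γ Y : Type*) where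
  idx : Γ
  pt : Y

namespace Copies

variable {Γ Y : Type*}

instance [Group Γ] : MulAction Γ (Copies Γ Y) where
  smul g c := ⟨g * c.idx, c.pt⟩
  one_smul c := by
    change (⟨1 * c.idx, c.pt⟩ : Copies Γ Y) = c
    rw [one_mul]
  mul_smul g h c := by
    change (⟨g * h * c.idx, c.pt⟩ : Copies Γ Y) = ⟨g * (h * c.idx), c.pt⟩
    rw [mul_assoc]

theorem smul_mk [Group Γ] (g h : Γ) (y : Y) : g • (⟨h, y⟩ : Copies Γ Y) = ⟨g * h, y⟩ := rfl

instance [Countable Γ] [Countable Y] : Countable (Copies Γ Y) :=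
  Function.Injective.countable (f := fun c : Copies Γ Y => (c.idx, c.pt)) fun c c' h => by
    cases c
    cases c'
    simpa using h

end Copies

open Classical in
/-- The disjoint union of `B` and `C`, with `F` giving the distances between the two parts, and
distances in `C` given by `dC` for related points and by `m` for unrelated ones. -/
noncomputable def glueDist {B C : Type*} (dB : B → B → ℚ) (E : C → C → Prop)
    (dC m : C → C → ℚ) (F : C → B → ℚ) : B ⊕ C → B ⊕ C → ℚ
  | .inl b, .inl b' => dB b b'
  | .inl b, .inr c => F c b
  | .inr c, .inl b => F c b
  | .inr c, .inr c' => if E c c' then dC c c' else m c c'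

/-- For unrelated points, `m` is the length of a shortest route through `B`. Since the minimum is
attained, each triangle inequality reduces to a detour through an optimal point of `B`. -/
theorem isRatPseudometric_glueDist {B C : Type*} {dB : B → B → ℚ} {E : C → C → Prop}
    {dC m : C → C → ℚ} {F : C → B → ℚ} (hB : IsRatPseudometric dB) (hE : Equivalence E)
    (hC0 : ∀ c, dC c c = 0) (hCs : ∀ c c', E c c' → dC c c' = dC c' c)
    (hCt : ∀ c c' c'', E c c' → E c' c'' → dC c c'' ≤ dC c c' + dC c' c'')
    (hF1 : ∀ c b b', F c b ≤ F c b' + dB b' b) (hF2 : ∀ c b b', dB b b' ≤ F c b + F c b')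
    (hF3 : ∀ c c' b, E c c' → F c b ≤ dC c c' + F c' b)
    (hF4 : ∀ c c' b, E c c' → dC c c' ≤ F c b + F c' b)
    (hm : ∀ c c' b, m c c' ≤ F c b + F c' b) (hm' : ∀ c c', ∃ b, m c c' = F c b + F c' b) :
    IsRatPseudometric (glueDist dB E dC m F) := by
  have ms : ∀ c c', m c c' = m c' c := by
    intro c c'
    obtain ⟨b, hb⟩ := hm' c c'
    obtain ⟨b', hb'⟩ := hm' c' c
    have := hm c c' b'
    have := hm c' c b
    linarith
  refine ⟨?_, ?_, ?_⟩
  · rintro (b | c)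
    · exact hB.self b
    · simp [glueDist, hE.refl c, hC0]
  · rintro (b | c) (b' | c')
    · exact hB.symm b b'
    · rfl
    · rfl
    · by_cases h : E c c'
      · simp [glueDist, h, hE.symm h, hCs c c' h]
      · have h' : ¬ E c' c := fun h' => h (hE.symm h')
        simp [glueDist, h, h', ms c c']
  · rintro (b | c) (b' | c') (b'' | c'')
    · exact hB.tri b b' b''
    · have := hF1 c'' b b'
      have := hB.symm b b'
      simp only [glueDist]
      linarith
    · have := hF2 c' b b''
      simpa [glueDist] using this
    · simp only [glueDist]
      split_ifs with h
      · have := hF3 c'' c' b (hE.symm h)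
        have := hCs c' c'' h
        linarith
      · obtain ⟨β, hβ⟩ := hm' c' c''
        have := hF1 c'' b β
        have := hF2 c' b β
        have := hB.symm b β
        linarith
    · have := hF1 c b'' b'
      simpa [glueDist] using this
    · simp only [glueDist]
      split_ifs with h
      · exact hF4 c c'' b' h
      · exact hm c c'' b'
    · simp only [glueDist]
      split_ifs with h
      · exact hF3 c c' b'' h
      · obtain ⟨β, hβ⟩ := hm' c c'
        have := hF1 c b'' β
        have := hF2 c' β b''
        linarith
    · simp only [glueDist]
      by_cases h1 : E c c' <;> by_cases h2 : E c' c''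
      · simp only [h1, h2, hE.trans h1 h2, if_true]
        exact hCt c c' c'' h1 h2
      · have h3 : ¬ E c c'' := fun h => h2 (hE.trans (hE.symm h1) h)
        simp only [h1, h2, h3, if_true, if_false]
        obtain ⟨β, hβ⟩ := hm' c' c''
        have := hm c c'' β
        have := hF3 c c' β h1
        linarith
      · have h3 : ¬ E c c'' := fun h => h1 (hE.trans h (hE.symm h2))
        simp only [h1, h2, h3, if_true, if_false]
        obtain ⟨β, hβ⟩ := hm' c c'
        have := hm c c'' β
        have := hF3 c'' c' β (hE.symm h2)
        have := hCs c' c'' h2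
        linarith
      · simp only [h1, h2, if_false]
        -- The route from `c` to `c''` passes `β`, `c'`, `β'`; replacing the middle part by `dB β
        -- β'` leaves a route through `β'` alone.
        obtain ⟨β, hβ⟩ := hm' c c'
        obtain ⟨β', hβ'⟩ := hm' c' c''
        have := hF2 c' β β'
        have := hF1 c β' β
        split_ifs with h3
        · have := hF4 c c'' β' h3
          linarith
        · have := hm c c'' β'
          linarith

/-- Amalgamation of a `Γ`-space `B` with the `Γ`-space induced from an `L`-space `Y`, given the
distances `r y i` from the points of `Y` to finitely many points `b i` of `B`. -/
theorem exists_amalgam {Γ L B Y I : Type*} [Group Γ] [Group L] [MulAction Γ B] [MulAction L Y]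
    [Finite I] [Nonempty I] (f : L →* Γ) (hf : Function.Injective f) {dB : B → B → ℚ}
    {dY : Y → Y → ℚ} (hB : IsRatPseudometric dB)
    (hBinv : ∀ (g : Γ) b b', dB (g • b) (g • b') = dB b b') (hY : IsRatPseudometric dY)
    (hYinv : ∀ (l : L) y y', dY (l • y) (l • y') = dY y y') (b : I → B) (r : Y → I → ℚ)
    (h1 : ∀ y i j, r y i ≤ r y j + dB (b i) (b j)) (h2 : ∀ y i j, dB (b i) (b j) ≤ r y i + r y j)
    (h3 : ∀ y y' i, r y i ≤ dY y y' + r y' i) (h4 : ∀ y y' i, dY y y' ≤ r y i + r y' i)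
    (h5 : ∀ l i, ∃ j, b j = f l • b i ∧ ∀ y, r (l • y) j = r y i) :
    ∃ D : B ⊕ Copies Γ Y → B ⊕ Copies Γ Y → ℚ, IsRatPseudometric D ∧
      (∀ (g : Γ) v w, D (g • v) (g • w) = D v w) ∧
      (∀ b b', D (.inl b) (.inl b') = dB b b') ∧
      (∀ y y', D (.inr ⟨1, y⟩) (.inr ⟨1, y'⟩) = dY y y') ∧
      (∀ l y, D (.inr ⟨f l, y⟩) (.inr ⟨1, l • y⟩) = 0) ∧
      (∀ y i, D (.inr ⟨1, y⟩) (.inl (b i)) = r y i) := by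
  classical
  cases nonempty_fintype I
  -- The largest distances between `Y` and `B` compatible with `r`.
  let F0 : Y → B → ℚ := fun y β =>
    Finset.univ.inf' Finset.univ_nonempty fun i => r y i + dB (b i) β
  have F0le : ∀ y β i, F0 y β ≤ r y i + dB (b i) β := fun y β i =>
    Finset.inf'_le (fun i => r y i + dB (b i) β) (Finset.mem_univ i)
  have F0ex : ∀ y β, ∃ i, F0 y β = r y i + dB (b i) β := fun y β => by
    obtain ⟨i, -, hi⟩ := Finset.exists_mem_eq_inf' (s := (Finset.univ : Finset I))
      Finset.univ_nonempty (fun i => r y i + dB (b i) β)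
    exact ⟨i, hi⟩
  have F0b : ∀ y i, F0 y (b i) = r y i := fun y i => by
    obtain ⟨j, hj⟩ := F0ex y (b i)
    have := F0le y (b i) i
    have := h1 y i j
    have := hB.self (b i)
    have := hB.symm (b i) (b j)
    linarith
  have F0inv_le : ∀ l y β, F0 (l • y) (f l • β) ≤ F0 y β := fun l y β => by
    obtain ⟨i, hi⟩ := F0ex y β
    obtain ⟨j, hj, hj'⟩ := h5 l i
    have := F0le (l • y) (f l • β) j
    rw [hj, hBinv, hj'] at this
    linarith
  have F0inv : ∀ l y β, F0 (l • y) (f l • β) = F0 y β := fun l y β => by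
    refine le_antisymm (F0inv_le l y β) ?_
    simpa using F0inv_le l⁻¹ (l • y) (f l • β)
  have F01 : ∀ y β β', F0 y β ≤ F0 y β' + dB β' β := fun y β β' => by
    obtain ⟨i, hi⟩ := F0ex y β'
    have := F0le y β i
    have := hB.tri (b i) β' β
    linarith
  have F02 : ∀ y β β', dB β β' ≤ F0 y β + F0 y β' := fun y β β' => by
    obtain ⟨i, hi⟩ := F0ex y β
    obtain ⟨j, hj⟩ := F0ex y β'
    have := h2 y i j
    have := hB.tri β (b i) β'
    have := hB.tri (b i) (b j) β'
    have := hB.symm β (b i)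
    linarith
  have F03 : ∀ y y' β, F0 y β ≤ dY y y' + F0 y' β := fun y y' β => by
    obtain ⟨i, hi⟩ := F0ex y' β
    have := F0le y β i
    have := h3 y y' i
    linarith
  have F04 : ∀ y y' β, dY y y' ≤ F0 y β + F0 y' β := fun y y' β => by
    obtain ⟨i, hi⟩ := F0ex y' β
    have := F01 y (b i) β
    have := F0b y i
    have := h4 y y' i
    have := hB.symm β (b i)
    linarith
  let F : Copies Γ Y → B → ℚ := fun c β => F0 c.pt (c.idx⁻¹ • β)
  have Finv : ∀ (g : Γ) c β, F (g • c) (g • β) = F c β := by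
    rintro g ⟨h, y⟩ β
    simp only [F, Copies.smul_mk, mul_inv_rev, mul_smul, inv_smul_smul]
  have Fl : ∀ (g : Γ) l y β, F ⟨g * f l, y⟩ β = F ⟨g, l • y⟩ β := by
    intro g l y β
    simp only [F, mul_inv_rev, mul_smul]
    rw [← F0inv l, smul_inv_smul]
  have F1 : ∀ c β β', F c β ≤ F c β' + dB β' β := fun c β β' => by
    have := F01 c.pt (c.idx⁻¹ • β) (c.idx⁻¹ • β')
    rwa [hBinv] at this
  have F2 : ∀ c β β', dB β β' ≤ F c β + F c β' := fun c β β' => by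
    have := F02 c.pt (c.idx⁻¹ • β) (c.idx⁻¹ • β')
    rwa [hBinv] at this
  -- Although `B` may be infinite, an optimal route from `c` into `B` already passes through one of
  -- the finitely many translates `c.idx • b i`, so the minimum is attained there.
  have hmin : ∀ c c', ∃ β, ∀ β', F c β + F c' β ≤ F c β' + F c' β' := by
    intro c c'
    obtain ⟨i, -, hi⟩ := Finset.exists_min_image (Finset.univ : Finset I)
      (fun i => F c (c.idx • b i) + F c' (c.idx • b i)) Finset.univ_nonempty
    refine ⟨c.idx • b i, fun β => ?_⟩
    obtain ⟨j, hj⟩ := F0ex c.pt (c.idx⁻¹ • β)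
    have e1 := hi j (Finset.mem_univ j)
    have e2 : F c (c.idx • b j) = r c.pt j := by simp only [F, inv_smul_smul, F0b]
    have e3 := F1 c' (c.idx • b j) β
    have e4 : dB (b j) (c.idx⁻¹ • β) = dB β (c.idx • b j) := by
      rw [← hBinv c.idx, smul_inv_smul, hB.symm]
    have e5 : F c β = r c.pt j + dB (b j) (c.idx⁻¹ • β) := hj
    linarith
  choose p hp using hmin
  let m : Copies Γ Y → Copies Γ Y → ℚ := fun c c' => F c (p c c') + F c' (p c c')
  have minv_le : ∀ (g : Γ) c c', m (g • c) (g • c') ≤ m c c' := fun g c c' => by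
    have := hp (g • c) (g • c') (g • p c c')
    rwa [Finv, Finv] at this
  have minv : ∀ (g : Γ) c c', m (g • c) (g • c') = m c c' := fun g c c' =>
    le_antisymm (minv_le g c c') (by simpa using minv_le g⁻¹ (g • c) (g • c'))
  -- Related copies have indices in the same left coset of the image of `f`. Identifying `(g * f l,
  -- y)` with `(g, l • y)` through distance zero gives the induced space without forming a quotient;
  -- injectivity of `f` makes `l` unique.
  let E : Copies Γ Y → Copies Γ Y → Prop := fun c c' => ∃ l, c.idx * f l = c'.idx
  let dC : Copies Γ Y → Copies Γ Y → ℚ := fun c c' =>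
    if h : E c c' then dY c.pt (h.choose • c'.pt) else 0
  have dCeq : ∀ c c' l, c.idx * f l = c'.idx → dC c c' = dY c.pt (l • c'.pt) := by
    intro c c' l h
    have hE : E c c' := ⟨l, h⟩
    have : hE.choose = l := hf (mul_left_cancel (hE.choose_spec.trans h.symm))
    simp only [dC, dif_pos hE, this]
  have hE : Equivalence E :=
    { refl := fun c => ⟨1, by simp⟩
      symm := by
        rintro c c' ⟨l, hl⟩
        exact ⟨l⁻¹, by rw [← hl, mul_assoc, ← map_mul, mul_inv_cancel, map_one, mul_one]⟩
      trans := by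
        rintro c c' c'' ⟨l, hl⟩ ⟨l', hl'⟩
        exact ⟨l * l', by rw [map_mul, ← mul_assoc, hl, hl']⟩ }
  have Einv : ∀ (g : Γ) c c', E (g • c) (g • c') ↔ E c c' := by
    rintro g ⟨h, y⟩ ⟨h', y'⟩
    simp only [E, Copies.smul_mk, mul_assoc, mul_right_inj]
  have dC0 : ∀ c, dC c c = 0 := fun c => by
    rw [dCeq c c 1 (by simp), one_smul, hY.self]
  have FE : ∀ (c c' : Copies Γ Y) l β, c.idx * f l = c'.idx → F c' β = F0 (l • c'.pt) (c.idx⁻¹ • β) := by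
    rintro ⟨g, y⟩ ⟨g', y'⟩ l β rfl
    exact Fl g l y' β
  have glueE : ∀ (c c' : Copies Γ Y) l, c.idx * f l = c'.idx →
      glueDist dB E dC m F (.inr c) (.inr c') = dY c.pt (l • c'.pt) := fun c c' l h => by
    rw [← dCeq c c' l h]
    exact if_pos ⟨l, h⟩
  refine ⟨glueDist dB E dC m F, isRatPseudometric_glueDist hB hE dC0 ?_ ?_ F1 F2 ?_ ?_ ?_ ?_,
    ?_, ?_, ?_, ?_, ?_⟩
  · rintro c c' ⟨l, hl⟩
    rw [dCeq c c' l hl, dCeq c' c l⁻¹ (by simp [← hl]), ← hYinv l⁻¹, inv_smul_smul, hY.symm]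
  · rintro c c' c'' ⟨l, hl⟩ ⟨l', hl'⟩
    rw [dCeq c c' l hl, dCeq c' c'' l' hl', dCeq c c'' (l * l') (by
      rw [map_mul, ← mul_assoc, hl, hl']), ← hYinv l c'.pt, mul_smul]
    exact hY.tri _ _ _
  · rintro c c' β ⟨l, hl⟩
    rw [dCeq c c' l hl, FE c c' l β hl]
    exact F03 _ _ _
  · rintro c c' β ⟨l, hl⟩
    rw [dCeq c c' l hl, FE c c' l β hl]
    exact F04 _ _ _
  · exact fun c c' β => hp c c' β
  · exact fun c c' => ⟨p c c', rfl⟩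
  · rintro g (β | c) (β' | c')
    · exact hBinv g β β'
    · exact Finv g c' β
    · exact Finv g c β'
    · change (if E (g • c) (g • c') then dC (g • c) (g • c') else m (g • c) (g • c')) =
        if E c c' then dC c c' else m c c'
      by_cases h : E c c'
      · obtain ⟨l, hl⟩ := h
        rw [if_pos ((Einv g c c').2 ⟨l, hl⟩), if_pos (show E c c' from ⟨l, hl⟩), dCeq c c' l hl,
          dCeq (g • c) (g • c') l]
        · rfl
        · change g * c.idx * f l = g * c'.idx
          rw [mul_assoc, hl]
      · rw [if_neg h, if_neg fun h' => h ((Einv g c c').1 h'), minv]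
  · exact fun _ _ => rfl
  · intro y y'
    rw [glueE ⟨1, y⟩ ⟨1, y'⟩ 1 (by simp), one_smul]
  · intro l y
    rw [glueE ⟨f l, y⟩ ⟨1, l • y⟩ l⁻¹ (by simp), inv_smul_smul, hY.self]
  · intro y i
    change F0 y ((1 : Γ)⁻¹ • b i) = _
    rw [inv_one, one_smul, F0b]

/-! ### Equivariant extension to a space with the point extension property. -/

/-- The finite set `S` of prescribed distances `(x, r)` can be realised in some extension. -/
def IsCompatible {X : Type*} (d : X → X → ℚ) (S : Finset (X × ℚ)) : Prop :=
  ∀ p ∈ S, ∀ q ∈ S, p.2 ≤ d p.1 q.1 + q.2 ∧ d p.1 q.1 ≤ p.2 + q.2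

/-- Every compatible finite set of prescribed distances is realised. -/
def HasPointExtension {X : Type*} (d : X → X → ℚ) : Prop :=
  ∀ S, IsCompatible d S → ∃ x, ∀ p ∈ S, d x p.1 = p.2

section Homogenize

variable (Γ V : Type*)

/-- The points of `V` and the first `k` copies of `Γ`. -/
def pointsBelow (k : ℕ) : Set (V ⊕ Copies Γ ℕ) := {t | ∀ c, t = .inr c → c.pt < k}

variable {Γ V}

theorem pointsBelow_mono {k l : ℕ} (h : k ≤ l) : pointsBelow Γ V k ⊆ pointsBelow Γ V l :=
  fun _ ht c hc => (ht c hc).trans_le h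

theorem inl_mem_pointsBelow (k : ℕ) (v : V) : .inl v ∈ pointsBelow Γ V k := fun c hc => by
  cases hc

theorem exists_mem_pointsBelow (t : V ⊕ Copies Γ ℕ) : ∃ k, t ∈ pointsBelow Γ V k := by
  rcases t with v | c
  · exact ⟨0, inl_mem_pointsBelow 0 v⟩
  · refine ⟨c.pt + 1, fun c' hc => ?_⟩
    cases hc
    exact Nat.lt_succ_self _

variable (Γ V) in
/-- An invariant pseudometric, considered as fixed on the points below a given level. -/
structure PartialExtension [Group Γ] [MulAction Γ V] where
  /-- The level below which the distances are final. -/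
  level : ℕ
  /-- The pseudometric. -/
  dist : V ⊕ Copies Γ ℕ → V ⊕ Copies Γ ℕ → ℚ
  isRat : IsRatPseudometric dist
  inv : ∀ (g : Γ) t t', dist (g • t) (g • t') = dist t t'

variable [Group Γ] [MulAction Γ V]

instance : Preorder (PartialExtension Γ V) where
  le p q := p.level ≤ q.level ∧
    ∀ t ∈ pointsBelow Γ V p.level, ∀ t' ∈ pointsBelow Γ V p.level, p.dist t t' = q.dist t t'
  le_refl _ := ⟨le_rfl, fun _ _ _ _ => rfl⟩
  le_trans _ _ _ h h' := ⟨h.1.trans h'.1, fun t ht t' ht' => (h.2 t ht t' ht').trans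
    (h'.2 t (pointsBelow_mono h.1 ht) t' (pointsBelow_mono h.1 ht'))⟩

theorem PartialExtension.exists_level_le (p : PartialExtension Γ V) (k : ℕ) :
    ∃ q, p ≤ q ∧ k ≤ q.level :=
  ⟨⟨max p.level k, p.dist, p.isRat, p.inv⟩, ⟨le_max_left _ _, fun _ _ _ _ => rfl⟩,
    le_max_right _ _⟩

/-- The new point spans a free orbit: this is amalgamation with a one-point space of the trivial
group, compatibility being exactly what the amalgam needs. -/
theorem PartialExtension.exists_realize [Nonempty V] (p : PartialExtension Γ V)
    (S : Finset ((V ⊕ Copies Γ ℕ) × ℚ)) (hS : ∀ z ∈ S, z.1 ∈ pointsBelow Γ V p.level)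
    (hc : IsCompatible p.dist S) :
    ∃ q, p ≤ q ∧ ∃ t ∈ pointsBelow Γ V q.level, ∀ z ∈ S, q.dist t z.1 = z.2 := by
  classical
  rcases S.eq_empty_or_nonempty with rfl | hne
  · exact ⟨p, le_rfl, .inl (Classical.arbitrary V), inl_mem_pointsBelow _ _, by simp⟩
  have : Nonempty S := hne.to_subtype
  obtain ⟨D, hD, hDinv, hD1, -, -, hD2⟩ := exists_amalgam (Γ := Γ) (L := (⊥ : Subgroup Γ))
    (Y := Unit) (I := S) (⊥ : Subgroup Γ).subtype (Subgroup.subtype_injective _)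
    (dY := fun _ _ => 0) p.isRat p.inv ⟨fun _ => rfl, fun _ _ => rfl, fun _ _ _ => by simp⟩
    (fun _ _ _ => rfl) (fun i => i.1.1) (fun _ i => i.1.2)
    (fun _ i j => by linarith [(hc i.1 i.2 j.1 j.2).1]) (fun _ i j => (hc i.1 i.2 j.1 j.2).2)
    (fun _ _ _ => by simp)
    (fun _ _ i => by
      have := (hc i.1 i.2 i.1 i.2).2
      rwa [p.isRat.self] at this)
    (fun l i => ⟨i, by
      obtain rfl : l = 1 := Subsingleton.elim _ _
      simp, fun _ => rfl⟩)
  -- The first copy of `Γ` that is not yet final becomes the new orbit; later copies keep their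
  -- provisional distances.
  let ρ : V ⊕ Copies Γ ℕ → (V ⊕ Copies Γ ℕ) ⊕ Copies Γ Unit := fun t => match t with
    | .inl v => .inl (.inl v)
    | .inr c => if c.pt = p.level then .inr ⟨c.idx, ()⟩ else .inl (.inr c)
  have hρ : ∀ t ∈ pointsBelow Γ V p.level, ρ t = .inl t := by
    rintro (v | c) ht
    · rfl
    · exact if_neg (ht c rfl).ne
  have hρ' : ∀ g : Γ, ρ (.inr ⟨g, p.level⟩) = .inr ⟨g, ()⟩ := fun g => if_pos rfl
  have hρg : ∀ (g : Γ) t, ρ (g • t) = g • ρ t := by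
    rintro g (v | ⟨h, n⟩)
    · rfl
    · change (if n = p.level then _ else _) = g • (if n = p.level then _ else _)
      split_ifs
      · rfl
      · rfl
  refine ⟨⟨p.level + 1, fun t t' => D (ρ t) (ρ t'), hD.comap ρ, fun g t t' => ?_⟩,
    ⟨Nat.le_succ _, fun t ht t' ht' => ?_⟩, .inr ⟨1, p.level⟩, fun c h => ?_, fun z hz => ?_⟩
  · rw [hρg, hρg, hDinv]
  · change _ = D (ρ t) (ρ t')
    rw [hρ t ht, hρ t' ht', hD1]
  · cases h
    exact Nat.lt_succ_self _
  · change D (ρ (.inr ⟨1, p.level⟩)) (ρ z.1) = z.2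
    rw [hρ', hρ z.1 (hS z hz)]
    exact hD2 () ⟨z, hz⟩

/-- Every countable `Γ`-space embeds into one with the point extension property. -/
theorem exists_hasPointExtension [Countable Γ] [Countable V] [Nonempty V] {d : V → V → ℚ}
    (hd : IsRatPseudometric d) (hinv : ∀ (g : Γ) v w, d (g • v) (g • w) = d v w) :
    ∃ D : V ⊕ Copies Γ ℕ → V ⊕ Copies Γ ℕ → ℚ, IsRatPseudometric D ∧
      (∀ (g : Γ) t t', D (g • t) (g • t') = D t t') ∧
      (∀ v w, D (.inl v) (.inl w) = d v w) ∧ HasPointExtension D := by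
  classical
  let v0 : V := Classical.arbitrary V
  -- Provisionally, every copy of `Γ` is placed on the orbit of `v0`.
  let ρ : V ⊕ Copies Γ ℕ → V := fun t => match t with
    | .inl v => v
    | .inr c => c.idx • v0
  have hρ : ∀ (g : Γ) t, ρ (g • t) = g • ρ t := by
    rintro g (v | c)
    · rfl
    · exact mul_smul g c.idx v0
  let p0 : PartialExtension Γ V :=
    ⟨0, fun t t' => d (ρ t) (ρ t'), hd.comap ρ, fun g t t' => by rw [hρ, hρ, hinv]⟩
  let 𝒟 : Finset ((V ⊕ Copies Γ ℕ) × ℚ) → Order.Cofinal (PartialExtension Γ V) := fun S =>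
    { carrier := {p | (∀ z ∈ S, z.1 ∈ pointsBelow Γ V p.level) ∧ (IsCompatible p.dist S →
        ∃ t ∈ pointsBelow Γ V p.level, ∀ z ∈ S, p.dist t z.1 = z.2)}
      isCofinal := by
        intro p
        choose k hk using exists_mem_pointsBelow (Γ := Γ) (V := V)
        obtain ⟨q, hpq, hq⟩ := p.exists_level_le (S.sup fun z => k z.1)
        have hS : ∀ z ∈ S, z.1 ∈ pointsBelow Γ V q.level := fun z hz =>
          pointsBelow_mono ((Finset.le_sup (f := fun z => k z.1) hz).trans hq) (hk z.1)
        by_cases hc : IsCompatible q.dist S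
        · obtain ⟨q', hqq, ht⟩ := q.exists_realize S hS hc
          exact ⟨q', ⟨fun z hz => pointsBelow_mono hqq.1 (hS z hz), fun _ => ht⟩, hpq.trans hqq⟩
        · exact ⟨q, ⟨hS, fun h => absurd h hc⟩, hpq⟩ }
  let _ : Encodable (Finset ((V ⊕ Copies Γ ℕ) × ℚ)) := Encodable.ofCountable _
  let s : ℕ → PartialExtension Γ V := Order.sequenceOfCofinals p0 𝒟
  have hs : Monotone s := Order.sequenceOfCofinals.monotone p0 𝒟
  have hmem : ∀ S, ∃ n, s n ∈ 𝒟 S := fun S => ⟨_, Order.sequenceOfCofinals.encode_mem p0 𝒟 S⟩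
  have hN : ∀ t, ∃ n, t ∈ pointsBelow Γ V (s n).level := fun t => by
    obtain ⟨n, hn⟩ := hmem {(t, 0)}
    exact ⟨n, hn.1 (t, 0) (by simp)⟩
  choose N hN using hN
  have hN' : ∀ t n, N t ≤ n → t ∈ pointsBelow Γ V (s n).level := fun t n h =>
    pointsBelow_mono (hs h).1 (hN t)
  let D : V ⊕ Copies Γ ℕ → V ⊕ Copies Γ ℕ → ℚ := fun t t' => (s (max (N t) (N t'))).dist t t'
  have hD : ∀ t t' n, t ∈ pointsBelow Γ V (s n).level → t' ∈ pointsBelow Γ V (s n).level →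
      D t t' = (s n).dist t t' := by
    intro t t' n ht ht'
    rw [(hs (le_max_left n (max (N t) (N t')))).2 t ht t' ht']
    exact (hs (le_max_right n (max (N t) (N t')))).2 t (hN' t _ (le_max_left _ _)) t'
      (hN' t' _ (le_max_right _ _))
  have hD' : ∀ t t' n, N t ≤ n → N t' ≤ n → D t t' = (s n).dist t t' := fun t t' n h h' =>
    hD t t' n (hN' t n h) (hN' t' n h')
  refine ⟨D, ⟨fun t => (s _).isRat.self t, fun t t' => ?_, fun t t' t'' => ?_⟩,
    fun g t t' => ?_, fun v w => ?_, fun S hS => ?_⟩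
  · rw [hD' t t' (N t + N t') (by omega) (by omega), hD' t' t (N t + N t') (by omega) (by omega)]
    exact (s _).isRat.symm t t'
  · rw [hD' t t'' (N t + N t' + N t'') (by omega) (by omega),
      hD' t t' (N t + N t' + N t'') (by omega) (by omega),
      hD' t' t'' (N t + N t' + N t'') (by omega) (by omega)]
    exact (s _).isRat.tri t t' t''
  · rw [hD' t t' (N t + N t' + N (g • t) + N (g • t')) (by omega) (by omega),
      hD' (g • t) (g • t') (N t + N t' + N (g • t) + N (g • t')) (by omega) (by omega)]
    exact (s _).inv g t t'
  · rw [hD _ _ 0 (inl_mem_pointsBelow _ v) (inl_mem_pointsBelow _ w)]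
    rfl
  · obtain ⟨n, hn⟩ := hmem S
    obtain ⟨t, ht, htS⟩ := hn.2 fun z hz w hw => by
      rw [← hD _ _ n (hn.1 z hz) (hn.1 w hw)]
      exact hS z hz w hw
    exact ⟨t, fun z hz => by rw [hD _ _ n ht (hn.1 z hz), htS z hz]⟩

end Homogenize

/-! ### Back-and-forth. -/

/-- Back-and-forth: a family of relations that extend to any given point on either side gives a
total relation that is a directed union of members of the family. -/
theorem exists_back_and_forth {X Y : Type*} [Countable X] [Countable Y] (P : Set (X × Y) → Prop)
    {p₀ : Set (X × Y)} (h₀ : P p₀)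
    (hX : ∀ p, P p → ∀ x, ∃ q, P q ∧ p ⊆ q ∧ ∃ y, (x, y) ∈ q)
    (hY : ∀ p, P p → ∀ y, ∃ q, P q ∧ p ⊆ q ∧ ∃ x, (x, y) ∈ q) :
    ∃ R : Set (X × Y), p₀ ⊆ R ∧ (∀ x, ∃ y, (x, y) ∈ R) ∧ (∀ y, ∃ x, (x, y) ∈ R) ∧
      ∀ z ∈ R, ∀ w ∈ R, ∃ p, P p ∧ p ⊆ R ∧ z ∈ p ∧ w ∈ p := by
  let 𝒟 : X ⊕ Y → Order.Cofinal {p // P p} := fun i =>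
    { carrier := {p | match i with
        | .inl x => ∃ y, (x, y) ∈ p.1
        | .inr y => ∃ x, (x, y) ∈ p.1}
      isCofinal := by
        rintro ⟨p, hp⟩
        rcases i with x | y
        · obtain ⟨q, hq, hpq, h⟩ := hX p hp x
          exact ⟨⟨q, hq⟩, h, hpq⟩
        · obtain ⟨q, hq, hpq, h⟩ := hY p hp y
          exact ⟨⟨q, hq⟩, h, hpq⟩ }
  let _ : Encodable (X ⊕ Y) := Encodable.ofCountable _
  let s : ℕ → {p // P p} := Order.sequenceOfCofinals ⟨p₀, h₀⟩ 𝒟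
  have hs : Monotone s := Order.sequenceOfCofinals.monotone _ 𝒟
  have hmem : ∀ i, ∃ n, s n ∈ 𝒟 i := fun i => ⟨_, Order.sequenceOfCofinals.encode_mem _ 𝒟 i⟩
  refine ⟨⋃ n, (s n).1, Set.subset_iUnion (fun n => (s n).1) 0, fun x => ?_, fun y => ?_, ?_⟩
  · obtain ⟨n, y, h⟩ := hmem (.inl x)
    exact ⟨y, Set.mem_iUnion.2 ⟨n, h⟩⟩
  · obtain ⟨n, x, h⟩ := hmem (.inr y)
    exact ⟨x, Set.mem_iUnion.2 ⟨n, h⟩⟩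
  · intro z hz w hw
    obtain ⟨n, hn⟩ := Set.mem_iUnion.1 hz
    obtain ⟨m, hm⟩ := Set.mem_iUnion.1 hw
    exact ⟨_, (s (max n m)).2, Set.subset_iUnion (fun n => (s n).1) _,
      hs (le_max_left n m) hn, hs (le_max_right n m) hm⟩

/-- The relation `p` preserves distances. -/
def IsIsometricRel {X Y : Type*} (dX : X → X → ℚ) (dY : Y → Y → ℚ) (p : Set (X × Y)) : Prop :=
  ∀ z ∈ p, ∀ w ∈ p, dX z.1 w.1 = dY z.2 w.2

theorem IsIsometricRel.swap {X Y : Type*} {dX : X → X → ℚ} {dY : Y → Y → ℚ} {p : Set (X × Y)}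
    (h : IsIsometricRel dX dY p) : IsIsometricRel dY dX (Prod.swap ⁻¹' p) :=
  fun z hz w hw => (h z.swap hz w.swap hw).symm

/-- The distances from `x` to the first coordinates of `p`, carried over to the second coordinates,
are compatible because `p` preserves distances. -/
theorem IsIsometricRel.exists_insert {X Y : Type*} {dX : X → X → ℚ} {dY : Y → Y → ℚ}
    (hX : IsRatPseudometric dX) (hY : IsRatPseudometric dY) (hYe : HasPointExtension dY)
    {p : Set (X × Y)} (hf : p.Finite) (hp : IsIsometricRel dX dY p) (x : X) :
    ∃ y, IsIsometricRel dX dY (insert (x, y) p) := by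
  classical
  obtain ⟨y, hy⟩ := hYe (hf.toFinset.image fun z => (z.2, dX x z.1)) (by
    intro a ha b hb
    obtain ⟨z, hz, rfl⟩ := Finset.mem_image.1 ha
    obtain ⟨w, hw, rfl⟩ := Finset.mem_image.1 hb
    simp only [Set.Finite.mem_toFinset] at hz hw
    simp only [← hp z hz w hw]
    have h1 := hX.tri x w.1 z.1
    have h2 := hX.tri z.1 x w.1
    rw [hX.symm z.1 x] at h2
    rw [hX.symm w.1 z.1] at h1
    constructor <;> linarith)
  have hy' : ∀ z ∈ p, dY y z.2 = dX x z.1 := fun z hz =>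
    hy (z.2, dX x z.1) (Finset.mem_image.2 ⟨z, hf.mem_toFinset.2 hz, rfl⟩)
  refine ⟨y, ?_⟩
  rintro z (rfl | hz) w (rfl | hw)
  · rw [hX.self, hY.self]
  · exact (hy' w hw).symm
  · rw [hX.symm, hY.symm]
    exact (hy' z hz).symm
  · exact hp z hz w hw

/-- Two countable spaces with the point extension property are isometric over any finite partial
isometry. -/
theorem exists_isometricRel {X Y : Type*} [Countable X] [Countable Y] {dX : X → X → ℚ}
    {dY : Y → Y → ℚ} (hX : IsRatPseudometric dX) (hY : IsRatPseudometric dY)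
    (hXe : HasPointExtension dX) (hYe : HasPointExtension dY)
    {p₀ : Set (X × Y)} (hf : p₀.Finite) (hp : IsIsometricRel dX dY p₀) :
    ∃ R : Set (X × Y), p₀ ⊆ R ∧ (∀ x, ∃ y, (x, y) ∈ R) ∧ (∀ y, ∃ x, (x, y) ∈ R) ∧
      IsIsometricRel dX dY R := by
  obtain ⟨R, h0, h1, h2, h3⟩ := exists_back_and_forth
    (fun p : Set (X × Y) => p.Finite ∧ IsIsometricRel dX dY p) ⟨hf, hp⟩
    (fun p hp x => by
      obtain ⟨y, hy⟩ := hp.2.exists_insert hX hY hYe hp.1 x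
      exact ⟨_, ⟨hp.1.insert _, hy⟩, Set.subset_insert _ _, y, Set.mem_insert _ _⟩)
    (fun p hp y => by
      obtain ⟨x, hx⟩ := hp.2.swap.exists_insert hY hX hXe
        (hp.1.preimage Prod.swap_injective.injOn) y
      refine ⟨insert (x, y) p, ⟨hp.1.insert _, ?_⟩, Set.subset_insert _ _, x, Set.mem_insert _ _⟩
      convert hx.swap using 1
      ext ⟨a, b⟩
      simp [and_comm])
  refine ⟨R, h0, h1, h2, fun z hz w hw => ?_⟩
  obtain ⟨p, hp, -, hz, hw⟩ := h3 z hz w hw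
  exact hp.2 z hz w hw

/-! ### Equivariant embeddings into the rational Urysohn space. -/

namespace RationalUrysohn

/-- The distance of the rational Urysohn space, as a rational number. -/
noncomputable def rdist (u v : RationalUrysohn) : ℚ := (isRationalUrysohn.rational u v).choose

theorem cast_rdist (u v : RationalUrysohn) : (rdist u v : ℝ) = dist u v :=
  (isRationalUrysohn.rational u v).choose_spec.symm

theorem rdist_pt (i j : ℕ) : rdist (pt i) (pt j) = qdist i j := by
  have := cast_rdist (pt i) (pt j)
  rw [dist_pt] at this
  exact_mod_cast this

theorem isRatPseudometric_rdist : IsRatPseudometric rdist := by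
  refine ⟨fun u => ?_, fun u v => ?_, fun u v w => ?_⟩
  · have := cast_rdist u u
    rw [dist_self] at this
    exact_mod_cast this
  · have := cast_rdist u v
    rw [dist_comm, ← cast_rdist] at this
    exact_mod_cast this
  · have := dist_triangle u v w
    rw [← cast_rdist, ← cast_rdist, ← cast_rdist] at this
    exact_mod_cast this

theorem eq_of_rdist {u v : RationalUrysohn} (h : rdist u v = 0) : u = v := by
  have := cast_rdist u v
  rw [h, Rat.cast_zero] at this
  exact dist_eq_zero.1 this.symm

theorem rdist_map (g : RationalUrysohn ≃ᵢ RationalUrysohn) (u v : RationalUrysohn) :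
    rdist (g u) (g v) = rdist u v := by
  have := g.isometry.dist_eq u v
  rw [← cast_rdist, ← cast_rdist] at this
  exact_mod_cast this

theorem hasPointExtension_rdist : HasPointExtension rdist := by
  intro S hS
  choose a ha using pt_surjective
  obtain ⟨n, hn⟩ := exists_point (ι := S) (fun p => a p.1.1) (fun p => p.1.2) (fun p q => by
    rw [← rdist_pt, ha, ha]
    exact hS p.1 p.2 q.1 q.2)
  refine ⟨pt n, fun p hp => ?_⟩
  have := hn ⟨p, hp⟩
  rwa [← rdist_pt, ha] at this

instance : Countable RationalUrysohn := isRationalUrysohn.countable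

instance : Nonempty RationalUrysohn := ⟨pt 0⟩

/-- An isometry of the rational Urysohn space from a surjective map preserving distances. -/
noncomputable def isometryEquivOfSurjective (e : RationalUrysohn → RationalUrysohn)
    (he : ∀ u v, rdist (e u) (e v) = rdist u v) (hs : Function.Surjective e) :
    RationalUrysohn ≃ᵢ RationalUrysohn :=
  have hi : Isometry e := Isometry.of_dist_eq fun u v => by rw [← cast_rdist, he, cast_rdist]
  ⟨Equiv.ofBijective e ⟨hi.injective, hs⟩, hi⟩

/-- Every countable `Γ`-space embeds equivariantly into the rational Urysohn space with a suitable
action of `Γ`, and the embedding may be prescribed on a finite set. -/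
theorem exists_equivariant_embedding {Γ V : Type*} [Group Γ] [Countable Γ] [Countable V]
    [Nonempty V] [MulAction Γ V] {d : V → V → ℚ} (hd : IsRatPseudometric d)
    (hinv : ∀ (g : Γ) v w, d (g • v) (g • w) = d v w) {p : Set (V × RationalUrysohn)}
    (hf : p.Finite) (hp : IsIsometricRel d rdist p) :
    ∃ (σ : Γ →* (RationalUrysohn ≃ᵢ RationalUrysohn)) (j : V → RationalUrysohn),
      (∀ v w, rdist (j v) (j w) = d v w) ∧ (∀ g v, j (g • v) = σ g (j v)) ∧
      ∀ z ∈ p, j z.1 = z.2 := by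
  obtain ⟨D, hD, hDinv, hDd, hDe⟩ := exists_hasPointExtension hd hinv
  obtain ⟨R, hR0, hR1, hR2, hR⟩ := exists_isometricRel hD isRatPseudometric_rdist hDe
    hasPointExtension_rdist (p₀ := (fun z : V × RationalUrysohn => (Sum.inl z.1, z.2)) '' p)
    (hf.image _) (by
      rintro _ ⟨z, hz, rfl⟩ _ ⟨w, hw, rfl⟩
      exact (hDd _ _).trans (hp z hz w hw))
  choose e he using hR1
  have hed : ∀ t t', rdist (e t) (e t') = D t t' := fun t t' => (hR _ (he t) _ (he t')).symm
  have huniq : ∀ t u, (t, u) ∈ R → e t = u := fun t u h =>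
    eq_of_rdist (by rw [← hR _ (he t) _ h]; exact hD.self t)
  have hsurj : Function.Surjective e := fun u => by
    obtain ⟨t, ht⟩ := hR2 u
    exact ⟨t, huniq t u ht⟩
  -- `e` identifies exactly the points at distance zero, so the action descends along it, computed
  -- by any section.
  let r := Function.surjInv hsurj
  have hr : ∀ u, e (r u) = u := Function.surjInv_eq hsurj
  have hact : ∀ (g : Γ) t, e (g • r (e t)) = e (g • t) := fun g t =>
    eq_of_rdist (by rw [hed, hDinv, ← hed, hr]; exact isRatPseudometric_rdist.self _)
  let σ : Γ → (RationalUrysohn ≃ᵢ RationalUrysohn) := fun g =>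
    isometryEquivOfSurjective (fun u => e (g • r u))
      (fun u v => by rw [hed, hDinv, ← hed, hr, hr])
      (fun u => ⟨e (g⁻¹ • r u), (hact g _).trans (by rw [smul_inv_smul, hr])⟩)
  have hσ : ∀ g t, σ g (e t) = e (g • t) := fun g t => hact g t
  refine ⟨MonoidHom.mk' σ fun g h => IsometryEquiv.ext fun u => ?_, fun v => e (.inl v),
    fun v w => by rw [hed, hDd], fun g v => (hσ g (.inl v)).symm, fun z hz => ?_⟩
  · obtain ⟨t, rfl⟩ := hsurj u
    change σ (g * h) (e t) = σ g (σ h (e t))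
    rw [hσ, hσ, hσ, mul_smul]
  · exact huniq _ _ (hR0 ⟨z, hz, rfl⟩)

end RationalUrysohn

/-! ### Closed sets in the profinite topology. -/

section Profinite

variable {Γ : Type*} [Group Γ]

theorem isOpen_profiniteTopology_iff {S : Set Γ} : IsOpen[profiniteTopology Γ] S ↔
    ∀ g ∈ S, ∃ K : Subgroup Γ, K.Normal ∧ K.FiniteIndex ∧ ∀ k ∈ K, g * k ∈ S := by
  constructor
  · intro h
    induction h with
    | basic S hS =>
      obtain ⟨x, K, hn, hf, rfl⟩ := hS
      rintro g ⟨k, hk, rfl⟩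
      exact ⟨K, hn, hf, fun k' hk' => ⟨k * k', K.mul_mem hk hk', (mul_assoc x k k').symm⟩⟩
    | univ => exact fun g _ => ⟨⊤, inferInstance, inferInstance, fun _ _ => trivial⟩
    | inter S T _ _ hS hT =>
      rintro g ⟨h1, h2⟩
      obtain ⟨K, hn, hf, hK⟩ := hS g h1
      obtain ⟨K', hn', hf', hK'⟩ := hT g h2
      exact ⟨K ⊓ K', inferInstance, inferInstance, fun k hk => ⟨hK k hk.1, hK' k hk.2⟩⟩
    | sUnion 𝒮 _ ih =>
      rintro g ⟨S, hS, hg⟩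
      obtain ⟨K, hn, hf, hK⟩ := ih S hS g hg
      exact ⟨K, hn, hf, fun k hk => ⟨S, hS, hK k hk⟩⟩
  · intro h
    let _ := profiniteTopology Γ
    refine isOpen_iff_forall_mem_open.2 fun g hg => ?_
    obtain ⟨K, hn, hf, hK⟩ := h g hg
    refine ⟨g • (K : Set Γ), ?_, TopologicalSpace.isOpen_generateFrom_of_mem ⟨g, K, hn, hf, rfl⟩,
      1, K.one_mem, mul_one g⟩
    rintro _ ⟨k, hk, rfl⟩
    exact hK k hk

theorem isClosed_profiniteTopology_iff {S : Set Γ} : IsClosed[profiniteTopology Γ] S ↔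
    ∀ g ∉ S, ∃ K : Subgroup Γ, K.Normal ∧ K.FiniteIndex ∧ ∀ k ∈ K, g * k ∉ S := by
  rw [← @isOpen_compl_iff _ _ (profiniteTopology Γ), isOpen_profiniteTopology_iff]
  rfl

/-- The coercion to sets in `HasRZ` acts on the list `L` itself, through the list monad; this is the
same list of sets in plain form. -/
theorem hasRZ_iff : HasRZ Γ ↔ ∀ L : List (Subgroup Γ), (∀ H ∈ L, H.FG) →
    IsClosed[profiniteTopology Γ] (L.map fun H : Subgroup Γ => (H : Set Γ)).prod := by
  have key : ∀ L : List (Subgroup Γ), (do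
      let a ← L
      pure (a : Set Γ)) = L.map fun H : Subgroup Γ => (H : Set Γ) := fun L => by
    rw [bind_pure_comp, List.map_eq_map]
  simp only [HasRZ, key, List.map_id']

/-- All products `H₁ H₂ ⋯ Hₙ S`, with the `Hᵢ` finitely generated subgroups, are closed in the
profinite topology. -/
def IsProductClosed (S : Set Γ) : Prop :=
  ∀ L : List (Subgroup Γ), (∀ H ∈ L, H.FG) →
    IsClosed[profiniteTopology Γ] ((L.map fun H : Subgroup Γ => (H : Set Γ)).prod * S)

theorem HasRZ.isProductClosed_one (h : HasRZ Γ) : IsProductClosed ({1} : Set Γ) := fun L hL => by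
  rw [Set.singleton_one, mul_one]
  exact hasRZ_iff.1 h L hL

theorem IsProductClosed.isClosed {S : Set Γ} (h : IsProductClosed S) :
    IsClosed[profiniteTopology Γ] S := by
  simpa using h [] (by simp)

theorem isProductClosed_empty : IsProductClosed (∅ : Set Γ) := fun L _ => by
  rw [Set.mul_empty]
  exact @isClosed_empty _ (profiniteTopology Γ)

theorem IsProductClosed.union {S T : Set Γ} (hS : IsProductClosed S) (hT : IsProductClosed T) :
    IsProductClosed (S ∪ T) := fun L hL => by
  rw [Set.mul_union]
  exact @IsClosed.union _ _ _ (profiniteTopology Γ) (hS L hL) (hT L hL)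

theorem isProductClosed_iUnion {ι : Type*} [Finite ι] {S : ι → Set Γ}
    (hS : ∀ i, IsProductClosed (S i)) : IsProductClosed (⋃ i, S i) := fun L hL => by
  rw [Set.mul_iUnion]
  exact @isClosed_iUnion_of_finite _ _ (profiniteTopology Γ) _ _ fun i => hS i L hL

theorem IsProductClosed.subgroup_mul {S : Set Γ} (hS : IsProductClosed S) {H : Subgroup Γ}
    (hH : H.FG) : IsProductClosed ((H : Set Γ) * S) := fun L hL => by
  have := hS (L ++ [H]) (by
    intro K hK
    rcases List.mem_append.1 hK with hK | hK
    · exact hL K hK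
    · rw [List.mem_singleton.1 hK]
      exact hH)
  simpa [mul_assoc] using this

/-- The element moves to the far left by `H g = g (g⁻¹ H g)`, conjugating the subgroups, and left
translation preserves closedness. -/
theorem IsProductClosed.singleton_mul {S : Set Γ} (hS : IsProductClosed S) (g : Γ) :
    IsProductClosed ({g} * S) := fun L hL => by
  have key : ∀ L : List (Subgroup Γ), (L.map fun H : Subgroup Γ => (H : Set Γ)).prod * {g} =
      {g} * ((L.map fun H : Subgroup Γ => H.map (MulAut.conj g⁻¹).toMonoidHom).map
        fun H : Subgroup Γ => (H : Set Γ)).prod := by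
    intro L
    induction L with
    | nil => simp
    | cons H L ih =>
      have hc : (H : Set Γ) * {g} = {g} * (H.map (MulAut.conj g⁻¹).toMonoidHom : Set Γ) := by
        ext x
        simp only [Set.mul_singleton, Set.singleton_mul, Set.mem_image, SetLike.mem_coe,
          Subgroup.coe_map, MulEquiv.coe_toMonoidHom, MulAut.conj_apply, inv_inv,
          exists_exists_and_eq_and]
        simp [mul_assoc]
      simp only [List.map_cons, List.prod_cons, mul_assoc, ih]
      rw [← mul_assoc, hc, mul_assoc]
  have h1 := hS (L.map fun H : Subgroup Γ => H.map (MulAut.conj g⁻¹).toMonoidHom) (by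
    intro K hK
    obtain ⟨H, hH, rfl⟩ := List.mem_map.1 hK
    exact (Subgroup.fg_iff_submonoid_fg _).2
      (((Subgroup.fg_iff_submonoid_fg H).1 (hL H hH)).map (MulAut.conj g⁻¹).toMonoidHom))
  rw [isClosed_profiniteTopology_iff] at h1
  rw [← mul_assoc, key, mul_assoc, isClosed_profiniteTopology_iff]
  intro x hx
  obtain ⟨K, hn, hf, hK⟩ := h1 (g⁻¹ * x) fun h => hx ⟨g, rfl, _, h, by simp⟩
  refine ⟨K, hn, hf, fun k hk hxk => hK k hk ?_⟩
  obtain ⟨_, rfl, y, hy, hxy⟩ := hxk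
  simp only at hxy
  rwa [mul_assoc, ← hxy, inv_mul_cancel_left]

end Profinite

/-! ### Weighted paths and path metrics over finite quotients. -/

section Path

/-- Paths from `(1, b)` to `(g, b')` of length `n`, in the weighted graph on `Δ × ι` with edges
of length zero from `(h, b)` to `(h g, c)` for `g ∈ T b c`, and edges of length `D c c'` from
`(h, c)` to `(h, c')`. -/
inductive WeightedPath {Δ ι : Type*} [Group Δ] (D : ι → ι → ℕ) (T : ι → ι → Set Δ) :
    ℕ → ι → ι → Δ → Prop
  | single {b c : ι} {g : Δ} : g ∈ T b c → WeightedPath D T 0 b c g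
  | cons {n : ℕ} {b c c' b' : ι} {g h : Δ} : g ∈ T b c → WeightedPath D T n c' b' h →
      WeightedPath D T (n + D c c') b b' (g * h)

namespace WeightedPath

variable {Δ ι : Type*} [Group Δ] {D : ι → ι → ℕ} {T : ι → ι → Set Δ}

theorem mul_left (hT : ∀ a b c g h, g ∈ T a b → h ∈ T b c → g * h ∈ T a c) {a b c : ι} {n : ℕ}
    {g h : Δ} (hg : g ∈ T a b) (p : WeightedPath D T n b c h) :
    WeightedPath D T n a c (g * h) := by
  cases p with
  | single hh => exact single (hT _ _ _ _ _ hg hh)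
  | cons hh p =>
    rw [← mul_assoc]
    exact cons (hT _ _ _ _ _ hg hh) p

theorem trans (hT : ∀ a b c g h, g ∈ T a b → h ∈ T b c → g * h ∈ T a c) {a b c : ι} {n m : ℕ}
    {g h : Δ} (p : WeightedPath D T n a b g) (q : WeightedPath D T m b c h) :
    WeightedPath D T (n + m) a c (g * h) := by
  induction p with
  | single hg =>
    rw [zero_add]
    exact q.mul_left hT hg
  | cons hg p ih =>
    rw [mul_assoc, add_right_comm]
    exact cons hg (ih q)

theorem edge (h1 : ∀ b, (1 : Δ) ∈ T b b) (b c : ι) : WeightedPath D T (D b c) b c (1 : Δ) := by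
  simpa using cons (h1 b) (single (h1 c) : WeightedPath D T 0 c c 1)

theorem symm (hT : ∀ a b c g h, g ∈ T a b → h ∈ T b c → g * h ∈ T a c)
    (h1 : ∀ b, (1 : Δ) ∈ T b b) (hinv : ∀ a b g, g ∈ T a b → g⁻¹ ∈ T b a)
    (hD : ∀ a b, D a b = D b a) {a b : ι} {n : ℕ} {g : Δ} (p : WeightedPath D T n a b g) :
    WeightedPath D T n b a g⁻¹ := by
  induction p with
  | single hg => exact single (hinv _ _ _ hg)
  | cons hg p ih =>
    rw [mul_inv_rev, hD]
    have := ih.trans hT ((edge h1 _ _).trans hT (single (hinv _ _ _ hg)))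
    simpa using this

/-- A `D`-edge of length zero is a loop, so it can be absorbed into the neighbouring `T`-steps. The
first remaining edge has positive length, which drives the induction in `isProductClosed`. -/
theorem exists_first_edge (hT : ∀ a b c g h, g ∈ T a b → h ∈ T b c → g * h ∈ T a c)
    (hD : ∀ a b, D a b = 0 → a = b) {a b : ι} {n : ℕ} {g : Δ} (p : WeightedPath D T n a b g) :
    g ∈ T a b ∨ ∃ c c' m x y, 0 < D c c' ∧ m + D c c' = n ∧ x ∈ T a c ∧
      WeightedPath D T m c' b y ∧ x * y = g := by
  induction p with
  | single hg => exact Or.inl hg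
  | @cons n a c c' b g h hg p ih =>
    rcases Nat.eq_zero_or_pos (D c c') with h0 | h0
    · obtain rfl := hD _ _ h0
      rcases ih with hh | ⟨d, d', m, x, y, h1, h2, h3, h4, rfl⟩
      · exact Or.inl (hT _ _ _ _ _ hg hh)
      · exact Or.inr ⟨d, d', m, g * x, y, h1, by omega, hT _ _ _ _ _ hg h3, h4, mul_assoc _ _ _⟩
    · exact Or.inr ⟨c, c', n, g, h, h0, rfl, hg, p, rfl⟩

/-- Splitting off the first edge of positive length writes the set as a finite union of products of
`T a c` with sets of smaller bound. Closedness alone would not survive multiplication by `T a c`,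
hence the stronger conclusion. -/
theorem isProductClosed [Finite ι] (hRZ : HasRZ Δ)
    (hT : ∀ a b c g h, g ∈ T a b → h ∈ T b c → g * h ∈ T a c)
    (hD : ∀ a b, D a b = 0 → a = b)
    (hcl : ∀ a b S, IsProductClosed S → IsProductClosed (T a b * S)) (N : ℕ) :
    ∀ a b, IsProductClosed {g | ∃ n ≤ N, WeightedPath D T n a b g} := by
  induction N using Nat.strong_induction_on with
  | _ N ih =>
    intro a b
    have heq : {g | ∃ n ≤ N, WeightedPath D T n a b g} = T a b * {1} ∪
        ⋃ q : {q : ι × ι // 0 < D q.1 q.2 ∧ D q.1 q.2 ≤ N}, T a q.1.1 *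
          {g | ∃ n ≤ N - D q.1.1 q.1.2, WeightedPath D T n q.1.2 b g} := by
      ext g
      constructor
      · rintro ⟨n, hn, p⟩
        rcases p.exists_first_edge hT hD with hg | ⟨c, c', m, x, y, h1, h2, h3, h4, rfl⟩
        · exact Or.inl ⟨g, hg, 1, rfl, mul_one g⟩
        · refine Or.inr (Set.mem_iUnion.2 ⟨⟨(c, c'), h1, by simp only; omega⟩, x, h3, y,
            ⟨m, by simp only; omega, h4⟩, rfl⟩)
      · rintro (⟨x, hx, y, rfl, rfl⟩ | h)
        · refine ⟨0, Nat.zero_le _, single ?_⟩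
          simpa using hx
        · obtain ⟨⟨⟨c, c'⟩, h1, h2⟩, x, hx, y, ⟨m, hm, p⟩, rfl⟩ := Set.mem_iUnion.1 h
          exact ⟨m + D c c', by simp only at hm h2; omega, cons hx p⟩
    rw [heq]
    refine (hcl _ _ _ hRZ.isProductClosed_one).union (isProductClosed_iUnion fun q => hcl _ _ _ ?_)
    exact ih _ (by have := q.2; omega) _ _

end WeightedPath

/-- The path metric modulo the kernel of `q`, with distances truncated at `C`. -/
noncomputable def pathDist {Δ Q ι : Type*} [Group Δ] [Group Q] (D : ι → ι → ℕ)
    (T : ι → ι → Set Δ) (q : Δ →* Q) (C : ℕ) (v w : Copies Δ ι) : ℕ :=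
  sInf {n | C ≤ n ∨ ∃ x, WeightedPath D T n v.pt w.pt x ∧ q x = (q v.idx)⁻¹ * q w.idx}

section PathDist

variable {Δ Q ι : Type*} [Group Δ] [Group Q] {D : ι → ι → ℕ} {T : ι → ι → Set Δ} {q : Δ →* Q}
  {C : ℕ}

theorem pathDist_le (v w : Copies Δ ι) : pathDist D T q C v w ≤ C :=
  Nat.sInf_le (Or.inl le_rfl)

theorem pathDist_le_of_path {v w : Copies Δ ι} {n : ℕ} {x : Δ}
    (p : WeightedPath D T n v.pt w.pt x) (hx : q x = (q v.idx)⁻¹ * q w.idx) :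
    pathDist D T q C v w ≤ n :=
  Nat.sInf_le (Or.inr ⟨x, p, hx⟩)

theorem pathDist_spec (v w : Copies Δ ι) : C ≤ pathDist D T q C v w ∨
    ∃ x, WeightedPath D T (pathDist D T q C v w) v.pt w.pt x ∧ q x = (q v.idx)⁻¹ * q w.idx :=
  Nat.sInf_mem (s := {n | C ≤ n ∨ ∃ x, WeightedPath D T n v.pt w.pt x ∧
    q x = (q v.idx)⁻¹ * q w.idx}) ⟨C, Or.inl le_rfl⟩

theorem pathDist_smul (g : Δ) (v w : Copies Δ ι) :
    pathDist D T q C (g • v) (g • w) = pathDist D T q C v w := by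
  obtain ⟨a, b⟩ := v
  obtain ⟨a', b'⟩ := w
  simp [pathDist, Copies.smul_mk, mul_assoc]

theorem pathDist_smul_self (h1 : ∀ b, (1 : Δ) ∈ T b b) {k : Δ} (hk : q k = 1)
    (v : Copies Δ ι) : pathDist D T q C (k • v) v = 0 :=
  Nat.le_zero.1 (pathDist_le_of_path (.single (h1 v.pt))
    (by obtain ⟨a, b⟩ := v; simp [Copies.smul_mk, hk]))

theorem isRatPseudometric_pathDist
    (hT : ∀ a b c g h, g ∈ T a b → h ∈ T b c → g * h ∈ T a c)
    (h1 : ∀ b, (1 : Δ) ∈ T b b) (hinv : ∀ a b g, g ∈ T a b → g⁻¹ ∈ T b a)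
    (hD : ∀ a b, D a b = D b a) :
    IsRatPseudometric fun v w => (pathDist D T q C v w : ℚ) := by
  have hs : ∀ v w, pathDist D T q C v w ≤ pathDist D T q C w v := by
    intro v w
    rcases pathDist_spec (D := D) (T := T) (q := q) (C := C) w v with h | ⟨x, p, hx⟩
    · exact (pathDist_le v w).trans h
    · exact pathDist_le_of_path (p.symm hT h1 hinv hD) (by rw [map_inv, hx]; simp)
  refine ⟨fun v => ?_, fun v w => ?_, fun u v w => ?_⟩
  · have := pathDist_smul_self (q := q) (D := D) (C := C) h1 (map_one q) v
    rw [one_smul] at this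
    simp [this]
  · exact_mod_cast le_antisymm (hs v w) (hs w v)
  · have : pathDist D T q C u w ≤ pathDist D T q C u v + pathDist D T q C v w := by
      rcases pathDist_spec (D := D) (T := T) (q := q) (C := C) u v with h | ⟨x, p, hx⟩
      · exact (pathDist_le u w).trans (h.trans (Nat.le_add_right _ _))
      rcases pathDist_spec (D := D) (T := T) (q := q) (C := C) v w with h | ⟨y, p', hy⟩
      · exact (pathDist_le u w).trans (h.trans (Nat.le_add_left _ _))
      exact pathDist_le_of_path (p.trans hT p') (by rw [map_mul, hx, hy]; simp [mul_assoc])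
    exact_mod_cast this

end PathDist

end Path

/-! ### Finite approximation from property (RZ). -/

theorem exists_common_denominator {ι : Type*} [Finite ι] (r : ι → ℚ) (hr : ∀ i, 0 ≤ r i) :
    ∃ M : ℕ, 0 < M ∧ ∀ i, ∃ n : ℕ, M * r i = n := by
  cases nonempty_fintype ι
  refine ⟨∏ i, (r i).den, Finset.prod_pos fun i _ => (r i).den_pos, fun i => ?_⟩
  obtain ⟨m, hm⟩ := Finset.dvd_prod_of_mem (fun i => (r i).den) (Finset.mem_univ i)
  refine ⟨m * (r i).num.toNat, ?_⟩
  have h1 : ((r i).den : ℚ) * r i = (r i).num := by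
    rw [mul_comm]
    exact Rat.mul_den_eq_num _
  have h2 : (((r i).num.toNat : ℤ) : ℚ) = (r i).num := by
    rw [Int.toNat_of_nonneg (Rat.num_nonneg.2 (hr i))]
  have h3 : (((r i).num.toNat : ℕ) : ℚ) = (r i).num := by exact_mod_cast h2
  rw [hm]
  push_cast
  rw [h3, ← h1]
  ring

/-- Finite approximation of isometric actions of groups with property (RZ): a finite piece of the
action is realised in an action that factors through a finite quotient. -/
theorem HasRZ.exists_finite_approximation {Δ X : Type*} [Group Δ] (hRZ : HasRZ Δ) [MulAction Δ X]
    {d : X → X → ℚ} (hd : IsRatPseudometric d) (hd0 : ∀ x y, d x y = 0 → x = y)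
    (hinv : ∀ (g : Δ) x y, d (g • x) (g • y) = d x y) (B : Finset X) (F : Finset Δ) :
    ∃ (K : Subgroup Δ) (dW : Copies Δ B → Copies Δ B → ℚ) (C : ℚ), K.FiniteIndex ∧
      IsRatPseudometric dW ∧ (∀ (g : Δ) v w, dW (g • v) (g • w) = dW v w) ∧
      (∀ v w, dW v w ≤ C) ∧ (∀ k ∈ K, ∀ v, dW (k • v) v = 0) ∧
      (∀ b b', dW ⟨1, b⟩ ⟨1, b'⟩ = d b b') ∧
      ∀ f ∈ F, ∀ b b' : B, f • b.1 = b'.1 → dW ⟨f, b⟩ ⟨1, b'⟩ = 0 := by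
  classical
  -- Scaling by `M` makes the distances on `B` natural numbers, so that induction on path length is
  -- possible.
  obtain ⟨M, hM, hMd⟩ := exists_common_denominator (fun p : B × B => d p.1.1 p.2.1)
    fun p => hd.nonneg _ _
  choose D' hD' using hMd
  let D : B → B → ℕ := fun b c => D' (b, c)
  have hD : ∀ b c, (M : ℚ) * d b.1 c.1 = D b c := fun b c => hD' (b, c)
  have hM' : (0 : ℚ) < M := by exact_mod_cast hM
  have hDs : ∀ b c, D b c = D c b := fun b c => by
    have := hD b c
    rw [hd.symm, hD] at this
    exact_mod_cast this.symm
  have hD0 : ∀ b c, D b c = 0 → b = c := fun b c h => by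
    have := hD b c
    rw [h, Nat.cast_zero, mul_eq_zero] at this
    exact Subtype.ext (hd0 _ _ (this.resolve_left hM'.ne'))
  -- representatives of the orbits
  let rep : X → X := fun x => (Quotient.mk (MulAction.orbitRel Δ X) x).out
  have hrep : ∀ x, ∃ g : Δ, g • rep x = x := fun x => by
    have := (MulAction.orbitRel Δ X).symm (Quotient.mk_out (s := MulAction.orbitRel Δ X) x)
    exact this
  have hrepg : ∀ (g : Δ) x, rep (g • x) = rep x := fun g x => by
    have : Quotient.mk (MulAction.orbitRel Δ X) (g • x) =
      Quotient.mk (MulAction.orbitRel Δ X) x := Quotient.sound ⟨g, rfl⟩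
    simp only [rep, this]
  choose t ht using hrep
  -- The moves of points of `B` by elements of `F`, transported to the orbit representative `x`.
  -- They are finitely many and fix `x`, so they generate a finitely generated subgroup of the
  -- stabiliser, which need not itself be finitely generated.
  let gens : X → Set Δ := fun x =>
    {η | ∃ f ∈ F, ∃ c c' : B, f • c.1 = c'.1 ∧ rep c.1 = x ∧ η = (t c'.1)⁻¹ * f * t c.1}
  have hgens : ∀ x, (gens x).Finite := fun x => by
    refine ((F ×ˢ (Finset.univ : Finset (B × B))).image
      fun p => (t p.2.2.1)⁻¹ * p.1 * t p.2.1.1).finite_toSet.subset ?_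
    rintro _ ⟨f, hf, c, c', -, -, rfl⟩
    exact Finset.mem_coe.2 (Finset.mem_image.2 ⟨(f, c, c'), by simp [hf], rfl⟩)
  let H : X → Subgroup Δ := fun x => Subgroup.closure (gens x)
  have hHfg : ∀ x, (H x).FG := fun x => ⟨(hgens x).toFinset, by simp [H]⟩
  have hHstab : ∀ x, ∀ η ∈ H x, η • x = x := fun x => by
    have : H x ≤ MulAction.stabilizer Δ x := by
      rw [Subgroup.closure_le]
      rintro _ ⟨f, hf, c, c', h1, rfl, rfl⟩
      rw [SetLike.mem_coe, MulAction.mem_stabilizer_iff, mul_smul, mul_smul, ht, h1, inv_smul_eq_iff,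
        ← hrepg f, h1, ht]
    exact fun η hη => this hη
  -- For `b` and `c` in the same orbit this is `t b * H * (t c)⁻¹`, all of whose elements take `c`
  -- to `b`; otherwise it is empty.
  let T : B → B → Set Δ := fun b c => {g | rep b.1 = rep c.1 ∧ (t b.1)⁻¹ * g * t c.1 ∈ H (rep b.1)}
  have hT1 : ∀ b, (1 : Δ) ∈ T b b := fun b => ⟨rfl, by simp [one_mem]⟩
  have hTm : ∀ a b c g h, g ∈ T a b → h ∈ T b c → g * h ∈ T a c := by
    rintro a b c g h ⟨h1, h2⟩ ⟨h3, h4⟩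
    refine ⟨h1.trans h3, ?_⟩
    rw [← h1] at h4
    have := mul_mem h2 h4
    simpa [mul_assoc] using this
  have hTi : ∀ a b g, g ∈ T a b → g⁻¹ ∈ T b a := by
    rintro a b g ⟨h1, h2⟩
    refine ⟨h1.symm, ?_⟩
    rw [← h1]
    simpa [mul_assoc] using inv_mem h2
  have hTs : ∀ a b g, g ∈ T a b → g • b.1 = a.1 := by
    rintro a b g ⟨h1, h2⟩
    have := hHstab _ _ h2
    rw [mul_smul, mul_smul, inv_smul_eq_iff, ht a.1, h1, ht] at this
    exact this
  have hTF : ∀ f ∈ F, ∀ b b' : B, f • b.1 = b'.1 → f⁻¹ ∈ T b b' := by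
    intro f hf b b' h
    refine hTi _ _ _ ⟨by rw [← h, hrepg], Subgroup.subset_closure ⟨f, hf, b, b', h, ?_, rfl⟩⟩
    rw [← h, hrepg]
  have hTcl : ∀ a b S, IsProductClosed S → IsProductClosed (T a b * S) := by
    intro a b S hS
    by_cases hab : rep a.1 = rep b.1
    · have : T a b = {t a.1} * ((H (rep a.1) : Set Δ) * {(t b.1)⁻¹}) := by
        ext g
        simp only [Set.singleton_mul, Set.mul_singleton, Set.mem_image, SetLike.mem_coe,
          exists_exists_and_eq_and]
        constructor
        · exact fun h => ⟨_, h.2, by simp [mul_assoc]⟩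
        · rintro ⟨η, hη, rfl⟩
          exact ⟨hab, by simpa [mul_assoc] using hη⟩
      rw [this, mul_assoc, mul_assoc]
      exact ((hS.singleton_mul _).subgroup_mul (hHfg _)).singleton_mul _
    · have : T a b = ∅ := Set.eq_empty_of_forall_notMem fun g hg => hab hg.1
      rw [this, Set.empty_mul]
      exact isProductClosed_empty
  -- Sending `(h, b)` to `h • b` maps paths into `X`, so a path is at least as long as the scaled
  -- distance of its ends.
  have hlen : ∀ n a b g, WeightedPath D T n a b g → M * d a.1 (g • b.1) ≤ n := by
    intro n a b g p
    induction p with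
    | single hg => rw [hTs _ _ _ hg, hd.self]; simp
    | @cons n a c c' b g h hg p ih =>
      rw [mul_smul, ← hTs _ _ _ hg, hinv]
      have h1 := mul_le_mul_of_nonneg_left (hd.tri c.1 c'.1 (h • b.1)) hM'.le
      rw [mul_add, hD] at h1
      push_cast
      linarith
  -- separate the short loops
  have hsep : ∀ p : B × B, ∃ K : Subgroup Δ, K.Normal ∧ K.FiniteIndex ∧
      ∀ k ∈ K, ∀ n, WeightedPath D T n p.1 p.2 k → D p.1 p.2 ≤ n := by
    rintro ⟨a, b⟩
    rcases Nat.eq_zero_or_pos (D a b) with h0 | h0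
    · exact ⟨⊤, inferInstance, inferInstance, fun _ _ n _ => by simp [h0]⟩
    -- Length at most `D a b - 1` means shorter than `D a b`, as `D a b` is positive. By `hlen`, no
    -- such path ends at `1`, so a neighbourhood `K` of `1` avoids all their endpoints.
    have hcl := (WeightedPath.isProductClosed hRZ hTm hD0 hTcl (D a b - 1) a b).isClosed
    obtain ⟨K, hn, hf, hK⟩ := isClosed_profiniteTopology_iff.1 hcl 1 (by
      rintro ⟨n, hn, p⟩
      have := hlen _ _ _ _ p
      rw [one_smul, hD] at this
      have : D a b ≤ n := by exact_mod_cast this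
      omega)
    refine ⟨K, hn, hf, fun k hk n p => ?_⟩
    by_contra hlt
    exact hK k hk (by rw [one_mul]; exact ⟨n, by simp only at hlt; omega, p⟩)
  choose K hKn hKf hK using hsep
  let N : Subgroup Δ := ⨅ p, K p
  have hNn : N.Normal := Subgroup.normal_iInf_normal hKn
  have hNf : N.FiniteIndex := Subgroup.finiteIndex_iInf hKf
  -- Truncation at the diameter of `B` keeps distances finite where no path exists and does not
  -- change those within `B`.
  let C : ℕ := Finset.univ.sup fun p : B × B => D p.1 p.2
  let q : Δ →* Δ ⧸ N := QuotientGroup.mk' N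
  have hq : ∀ k, q k = 1 ↔ k ∈ N := fun k => QuotientGroup.eq_one_iff k
  refine ⟨N, fun v w => pathDist D T q C v w / M, C / M, hNf,
    ?_, fun g v w => ?_, fun v w => ?_, fun k hk v => ?_, fun b b' => ?_, fun f hf b b' h => ?_⟩
  · have h := isRatPseudometric_pathDist (q := q) (C := C) hTm hT1 hTi hDs
    refine ⟨fun v => ?_, fun v w => ?_, fun u v w => ?_⟩
    · rw [h.self, zero_div]
    · rw [h.symm]
    · rw [← add_div]
      exact div_le_div_of_nonneg_right (h.tri u v w) hM'.le
  · simp only [pathDist_smul]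
  · exact div_le_div_of_nonneg_right (by exact_mod_cast pathDist_le v w) hM'.le
  · simp only [pathDist_smul_self hT1 ((hq k).2 hk), Nat.cast_zero, zero_div]
  · rw [div_eq_iff hM'.ne', mul_comm, hD]
    norm_cast
    refine le_antisymm (pathDist_le_of_path (WeightedPath.edge hT1 b b') (by simp)) ?_
    rcases pathDist_spec (D := D) (T := T) (q := q) (C := C) ⟨1, b⟩ ⟨1, b'⟩ with h | ⟨x, p, hx⟩
    · exact (Finset.le_sup (f := fun p : B × B => D p.1 p.2) (Finset.mem_univ (b, b'))).trans h
    · refine hK (b, b') x ?_ _ p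
      have : x ∈ N := (hq x).1 (by simpa using hx)
      exact (Subgroup.mem_iInf.1 this) (b, b')
  · have := pathDist_le_of_path (C := C) (v := ⟨f, b⟩) (w := ⟨1, b'⟩) (q := q)
      (WeightedPath.single (D := D) (hTF f hf b b' h)) (by simp)
    simp only [Nat.le_zero.1 this, Nat.cast_zero, zero_div]

/-! ### The topology of the space of representations. -/

/-- The isometry group of the rational Urysohn space. -/
abbrev UrysohnGroup : Type := RationalUrysohn ≃ᵢ RationalUrysohn

section RepTopology

variable {Γ : Type*} [Group Γ]

theorem nhds_pi_of_discrete {ι Y : Type*} [TopologicalSpace Y] [DiscreteTopology Y] (g : ι → Y) :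
    𝓝 g = ⨅ i, 𝓟 {h | h i = g i} := by
  rw [nhds_pi, Filter.pi]
  refine iInf_congr fun i => ?_
  rw [nhds_discrete, Filter.comap_pure]
  rfl

theorem nhds_repTopology (π : Γ →* UrysohnGroup) : @nhds _ (repTopology Γ UrysohnGroup) π =
    ⨅ z : Γ × RationalUrysohn, 𝓟 {σ | σ z.1 z.2 = π z.1 z.2} := by
  have h1 : ∀ g : UrysohnGroup, 𝓝 g = ⨅ u, 𝓟 {h : UrysohnGroup | h u = g u} := by
    intro g
    rw [@nhds_induced _ _ (@Pi.topologicalSpace _ (fun _ => RationalUrysohn) fun _ => ⊥),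
      @nhds_pi_of_discrete _ _ ⊥ (discreteTopology_bot _), Filter.comap_iInf]
    refine iInf_congr fun u => ?_
    rw [Filter.comap_principal]
    rfl
  rw [nhds_induced, nhds_pi, Filter.pi, Filter.comap_iInf, iInf_prod]
  refine iInf_congr fun γ => ?_
  rw [h1, Filter.comap_comap, Filter.comap_iInf]
  refine iInf_congr fun u => ?_
  rw [Filter.comap_principal]
  rfl

theorem mem_nhds_repTopology {π : Γ →* UrysohnGroup} {O : Set (Γ →* UrysohnGroup)} :
    O ∈ @nhds _ (repTopology Γ UrysohnGroup) π ↔ ∃ t : Set (Γ × RationalUrysohn), t.Finite ∧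
      ∀ σ : Γ →* UrysohnGroup, (∀ z ∈ t, σ z.1 z.2 = π z.1 z.2) → σ ∈ O := by
  rw [nhds_repTopology, (Filter.hasBasis_iInf_principal_finite _).mem_iff]
  refine exists_congr fun t => and_congr_right fun _ => ?_
  simp only [Set.subset_def, Set.mem_iInter, Set.mem_ofPred_eq]

theorem mem_residual_repTopology {O : Set (Γ →* UrysohnGroup)}
    (ho : IsOpen[repTopology Γ UrysohnGroup] O)
    (hd : ∀ (π : Γ →* UrysohnGroup) (t : Set (Γ × RationalUrysohn)), t.Finite →
      ∃ σ ∈ O, ∀ z ∈ t, σ z.1 z.2 = π z.1 z.2) :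
    O ∈ @residual _ (repTopology Γ UrysohnGroup) := by
  let _ := repTopology Γ UrysohnGroup
  refine residual_of_dense_open ho fun π => mem_closure_iff_nhds.2 fun s hs => ?_
  obtain ⟨t, ht, h⟩ := mem_nhds_repTopology.1 hs
  obtain ⟨σ, hσ, hσt⟩ := hd π t ht
  exact ⟨σ, h σ hσt, hσ⟩

/-- Coding values by natural numbers embeds the space as a closed subset of a countable power of ℕ:
multiplicativity and preservation of distances each involve finitely many values, and surjectivity
follows from the values at `γ⁻¹`. -/
theorem baireSpace_repTopology [Countable Γ] :
    @BaireSpace (Γ →* UrysohnGroup) (repTopology Γ UrysohnGroup) := by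
  let _ := repTopology Γ UrysohnGroup
  let _ : Encodable RationalUrysohn := Encodable.ofCountable _
  let Φ : (Γ →* UrysohnGroup) → Γ × RationalUrysohn → ℕ := fun π z => Encodable.encode (π z.1 z.2)
  have hΦ : Topology.IsInducing Φ := by
    refine Topology.isInducing_iff_nhds.2 fun π => ?_
    rw [nhds_repTopology, nhds_pi_of_discrete, Filter.comap_iInf]
    refine iInf_congr fun z => ?_
    rw [Filter.comap_principal]
    congr 1
    ext σ
    simp [Φ]
  have hinj : Function.Injective Φ := fun π σ h => MonoidHom.ext fun γ => IsometryEquiv.ext fun u =>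
    Encodable.encode_injective (congrFun h (γ, u))
  have hcl : IsClosed (Set.range Φ) := by
    refine isClosed_of_closure_subset fun φ hφ => ?_
    have key : ∀ t : Set (Γ × RationalUrysohn), t.Finite →
        ∃ π : Γ →* UrysohnGroup, ∀ z ∈ t, φ z = Encodable.encode (π z.1 z.2) := by
      intro t ht
      obtain ⟨_, hψ, π, rfl⟩ := mem_closure_iff_nhds.1 hφ (t.pi fun z => {φ z})
        (set_pi_mem_nhds ht fun z _ => by simp)
      exact ⟨π, fun z hz => (hψ z hz).symm⟩
    have hex : ∀ z, ∃ u : RationalUrysohn, Encodable.encode u = φ z := fun z => by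
      obtain ⟨π, hπ⟩ := key {z} (Set.finite_singleton z)
      exact ⟨π z.1 z.2, (hπ z rfl).symm⟩
    choose F hF using hex
    have key' : ∀ t : Set (Γ × RationalUrysohn), t.Finite →
        ∃ π : Γ →* UrysohnGroup, ∀ z ∈ t, F z = π z.1 z.2 := by
      intro t ht
      obtain ⟨π, hπ⟩ := key t ht
      exact ⟨π, fun z hz => Encodable.encode_injective ((hF z).trans (hπ z hz))⟩
    have hmul : ∀ γ δ u, F (γ * δ, u) = F (γ, F (δ, u)) := by
      intro γ δ u
      obtain ⟨π, hπ⟩ := key' {(γ * δ, u), (γ, F (δ, u)), (δ, u)} (by simp)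
      rw [hπ (γ * δ, u) (by simp), hπ (γ, F (δ, u)) (by simp), map_mul, hπ (δ, u) (by simp)]
      rfl
    have hone : ∀ u, F (1, u) = u := by
      intro u
      obtain ⟨π, hπ⟩ := key' {(1, u)} (by simp)
      rw [hπ (1, u) (by simp), map_one]
      rfl
    have hdist : ∀ γ u v, (F (γ, u)).rdist (F (γ, v)) = u.rdist v := by
      intro γ u v
      obtain ⟨π, hπ⟩ := key' {(γ, u), (γ, v)} (by simp)
      rw [hπ (γ, u) (by simp), hπ (γ, v) (by simp), RationalUrysohn.rdist_map]
    let σ : Γ → UrysohnGroup := fun γ => RationalUrysohn.isometryEquivOfSurjective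
      (fun u => F (γ, u)) (hdist γ) fun u => ⟨F (γ⁻¹, u), (hmul γ γ⁻¹ u).symm.trans (by rw [mul_inv_cancel, hone])⟩
    refine ⟨MonoidHom.mk' σ fun γ δ => IsometryEquiv.ext fun u => hmul γ δ u, ?_⟩
    ext z
    exact hF z
  have : TopologicalSpace.IsCompletelyPseudoMetrizableSpace (Γ →* UrysohnGroup) :=
    Topology.IsClosedEmbedding.IsCompletelyPseudoMetrizableSpace
      (f := Φ) ⟨⟨hΦ, hinj⟩, hcl⟩
  infer_instance

end RepTopology

/-! ### Universal actions and their conjugacy. -/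

section Universal

open RationalUrysohn

variable {L : Type*} [Group L]

/-- The actions with finite orbits that are universal and homogeneous for finite `L`-spaces. -/
structure IsUniversalAction (π : L →* UrysohnGroup) : Prop where
  fixed : ∃ u, ∀ l, π l u = u
  finite : ∀ u, (Set.range fun l => π l u).Finite
  extend : ∀ (n : ℕ) (a : L →* Equiv.Perm (Fin n)) (d : Fin n → Fin n → ℚ)
    (q : Finset (Fin n × RationalUrysohn)), IsRatPseudometric d →
    (∀ l i j, d (a l i) (a l j) = d i j) → q.Nonempty → IsIsometricRel d rdist (q : Set _) →
    (∀ l, ∀ z ∈ q, (a l z.1, π l z.2) ∈ q) →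
    ∃ ψ : Fin n → RationalUrysohn, (∀ i j, rdist (ψ i) (ψ j) = d i j) ∧
      (∀ l i, ψ (a l i) = π l (ψ i)) ∧ ∀ z ∈ q, ψ z.1 = z.2

/-- Finite invariant sets are modelled on `Fin n`, so that universality becomes a countable family
of conditions. -/
theorem exists_fin_model (π : L →* UrysohnGroup) {S : Set RationalUrysohn} (hS : S.Finite)
    (hinv : ∀ l, ∀ u ∈ S, π l u ∈ S) :
    ∃ (n : ℕ) (a : L →* Equiv.Perm (Fin n)) (ψ : Fin n → RationalUrysohn), Function.Injective ψ ∧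
      Set.range ψ = S ∧ ∀ l i, ψ (a l i) = π l (ψ i) := by
  have : Finite S := hS
  let e := Finite.equivFin S
  let _ : MulAction L S :=
    { smul := fun l u => ⟨π l u, hinv l u u.2⟩
      one_smul := fun u => Subtype.ext (by change π 1 u = u; rw [map_one]; rfl)
      mul_smul := fun l l' u => Subtype.ext (by
        change π (l * l') u = π l (π l' u)
        rw [map_mul]
        rfl) }
  refine ⟨Nat.card S, e.permCongrHom.toMonoidHom.comp (MulAction.toPermHom L S),
    fun i => (e.symm i).1, Subtype.val_injective.comp e.symm.injective, ?_, fun l i => ?_⟩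
  · rw [Set.range_comp' Subtype.val e.symm, e.symm.surjective.range_eq, Set.image_univ,
      Subtype.range_coe]
  · change (e.symm (e (l • e.symm i))).1 = _
    rw [e.symm_apply_apply]
    rfl

/-- Finite nonempty equivariant partial isometries. -/
structure IsEquivariantRel (π σ : L →* UrysohnGroup) (p : Set (RationalUrysohn × RationalUrysohn)) :
    Prop where
  finite : p.Finite
  nonempty : p.Nonempty
  isometric : IsIsometricRel rdist rdist p
  map_mem : ∀ l, ∀ z ∈ p, (π l z.1, σ l z.2) ∈ p

theorem IsEquivariantRel.swap {π σ : L →* UrysohnGroup}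
    {p : Set (RationalUrysohn × RationalUrysohn)} (h : IsEquivariantRel π σ p) :
    IsEquivariantRel σ π (Prod.swap ⁻¹' p) where
  finite := h.finite.preimage Prod.swap_injective.injOn
  nonempty := h.nonempty.preimage Prod.swap_surjective
  isometric := h.isometric.swap
  map_mem l z hz := h.map_mem l z.swap hz

/-- The first coordinates of `p` together with the orbit of `x` form a finite `π`-space, and the
universality of `σ` realises it over the second coordinates of `p`. -/
theorem IsEquivariantRel.exists_extend {π σ : L →* UrysohnGroup} (hπ : IsUniversalAction π)
    (hσ : IsUniversalAction σ) {p : Set (RationalUrysohn × RationalUrysohn)}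
    (hp : IsEquivariantRel π σ p) (x : RationalUrysohn) :
    ∃ q, IsEquivariantRel π σ q ∧ p ⊆ q ∧ ∃ y, (x, y) ∈ q := by
  obtain ⟨n, a, φ, hinj, hr, heq⟩ := exists_fin_model π
    (S := Prod.fst '' p ∪ Set.range fun l => π l x) ((hp.finite.image _).union (hπ.finite x)) (by
      rintro l _ (⟨z, hz, rfl⟩ | ⟨l', rfl⟩)
      · exact Or.inl ⟨_, hp.map_mem l z hz, rfl⟩
      · exact Or.inr ⟨l * l', by simp only [map_mul]; rfl⟩)
  have hfst : ∀ z ∈ p, ∃ i, φ i = z.1 := fun z hz => by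
    rw [← Set.mem_range, hr]
    exact Or.inl ⟨z, hz, rfl⟩
  have hqf : ((fun z : Fin n × RationalUrysohn => (φ z.1, z.2)) ⁻¹' p).Finite :=
    hp.finite.preimage fun z _ w _ h => by
      simp only [Prod.mk.injEq] at h
      exact Prod.ext (hinj h.1) h.2
  obtain ⟨ψ, h1, h2, h3⟩ := hσ.extend n a (fun i j => rdist (φ i) (φ j)) hqf.toFinset
    (isRatPseudometric_rdist.comap φ)
    (fun l i j => by rw [heq, heq, rdist_map]) (by
      obtain ⟨z, hz⟩ := hp.nonempty
      obtain ⟨i, hi⟩ := hfst z hz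
      exact ⟨(i, z.2), by simpa [hi] using hz⟩) (by
      intro z hz w hw
      simp only [Set.Finite.coe_toFinset] at hz hw
      exact hp.isometric _ hz _ hw) (by
      intro l z hz
      simp only [Set.Finite.mem_toFinset, Set.mem_preimage] at hz ⊢
      rw [heq]
      exact hp.map_mem l _ hz)
  refine ⟨Set.range fun i => (φ i, ψ i), ⟨Set.finite_range _, ?_, ?_, ?_⟩, ?_, ?_⟩
  · obtain ⟨z, hz⟩ := hp.nonempty
    obtain ⟨i, -⟩ := hfst z hz
    exact ⟨_, i, rfl⟩
  · rintro _ ⟨i, rfl⟩ _ ⟨j, rfl⟩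
    exact (h1 i j).symm
  · rintro l _ ⟨i, rfl⟩
    exact ⟨a l i, Prod.ext (heq l i) (h2 l i)⟩
  · intro z hz
    obtain ⟨i, hi⟩ := hfst z hz
    exact ⟨i, Prod.ext hi (h3 (i, z.2) (by simpa [hi] using hz))⟩
  · obtain ⟨i, hi⟩ : x ∈ Set.range φ := by
      rw [hr]
      exact Or.inr ⟨1, by simp only [map_one]; rfl⟩
    exact ⟨ψ i, i, by simp only [hi]⟩

/-- The back-and-forth starts from a pair of fixed points, because the extension property needs a
nonempty base. Its limit is a union of equivariant relations, hence the graph of a conjugating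
isometry. -/
theorem IsUniversalAction.mem_conjOrbit {π σ : L →* UrysohnGroup} (hπ : IsUniversalAction π)
    (hσ : IsUniversalAction σ) : σ ∈ conjOrbit π := by
  obtain ⟨u₀, hu⟩ := hπ.fixed
  obtain ⟨v₀, hv⟩ := hσ.fixed
  obtain ⟨R, -, h1, h2, h3⟩ := exists_back_and_forth (IsEquivariantRel π σ) (p₀ := {(u₀, v₀)})
    ⟨Set.finite_singleton _, Set.singleton_nonempty _, by
      rintro z rfl w rfl
      rw [isRatPseudometric_rdist.self, isRatPseudometric_rdist.self], by
      rintro l z rfl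
      rw [hu, hv]
      rfl⟩
    (fun p hp x => hp.exists_extend hπ hσ x)
    (fun p hp y => by
      obtain ⟨q, hq, hpq, x, hx⟩ := hp.swap.exists_extend hσ hπ y
      exact ⟨_, hq.swap, fun z hz => hpq (by simpa using hz), x, hx⟩)
  have hR : IsIsometricRel rdist rdist R := fun z hz w hw => by
    obtain ⟨p, hp, -, hz, hw⟩ := h3 z hz w hw
    exact hp.isometric z hz w hw
  choose e he using h1
  have huniq : ∀ u v, (u, v) ∈ R → e u = v := fun u v h =>
    eq_of_rdist (by rw [← hR _ (he u) _ h]; exact isRatPseudometric_rdist.self _)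
  let g : UrysohnGroup := isometryEquivOfSurjective e (fun u v => (hR _ (he u) _ (he v)).symm)
    fun v => by
      obtain ⟨u, hu⟩ := h2 v
      exact ⟨u, huniq u v hu⟩
  refine ⟨g, fun l => eq_mul_inv_of_mul_eq (IsometryEquiv.ext fun u => ?_)⟩
  obtain ⟨p, hp, hpR, hz, -⟩ := h3 _ (he u) _ (he u)
  exact (huniq _ _ (hpR (hp.map_mem l _ hz))).symm

end Universal

/-! ### Universality is a comeagre condition. -/

section Residual

open RationalUrysohn

variable {Γ L : Type*} [Group Γ] [Group L]

theorem Group.FG.countable_hom_of_finite (hL : Group.FG L) (M : Type*) [Group M] [Finite M] :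
    Countable (L →* M) := by
  obtain ⟨S, hS⟩ := Group.fg_def.1 hL
  refine Function.Injective.countable (f := fun (φ : L →* M) (s : S) => φ s) fun φ ψ h => ?_
  exact MonoidHom.eq_of_eqOn_dense hS fun s hs => congrFun h ⟨s, hs⟩

/-- Equivariance on a finite set need only be tested on generators, so it depends on finitely many
values of `π`. -/
theorem isOpen_setOf_equivariant (hL : Group.FG L) (f : L →* Γ) {n : ℕ}
    (a : L →* Equiv.Perm (Fin n)) (ψ : Fin n → RationalUrysohn) :
    IsOpen[repTopology Γ UrysohnGroup]
      {π : Γ →* UrysohnGroup | ∀ l i, ψ (a l i) = π (f l) (ψ i)} := by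
  let _ := repTopology Γ UrysohnGroup
  refine isOpen_iff_mem_nhds.2 fun π hπ => mem_nhds_repTopology.2 ?_
  obtain ⟨S, hS⟩ := Group.fg_def.1 hL
  refine ⟨(fun p : L × Fin n => (f p.1, ψ p.2)) '' ((S : Set L) ×ˢ Set.univ),
    (S.finite_toSet.prod Set.finite_univ).image _, fun σ hσ l => ?_⟩
  have hl : l ∈ Subgroup.closure (S : Set L) := hS ▸ Subgroup.mem_top l
  induction hl using Subgroup.closure_induction with
  | mem s hs =>
    intro i
    rw [hσ (f s, ψ i) ⟨(s, i), ⟨hs, trivial⟩, rfl⟩]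
    exact hπ s i
  | one => intro i; simp
  | mul l l' _ _ h h' =>
    intro i
    rw [map_mul, map_mul, map_mul]
    exact (h _).trans (congrArg _ (h' i))
  | inv l _ h =>
    intro i
    have := h (a l⁻¹ i)
    rw [← Equiv.Perm.mul_apply, ← map_mul, mul_inv_cancel, map_one, Equiv.Perm.one_apply] at this
    rw [this, ← IsometryEquiv.mul_apply, ← map_mul, ← map_mul, inv_mul_cancel, map_one, map_one]
    rfl

theorem finite_range_of_finiteIndex {Δ X : Type*} [Group Δ] (K : Subgroup Δ) [K.FiniteIndex]
    (φ : Δ → X) (h : ∀ k ∈ K, ∀ δ, φ (k * δ) = φ δ) : (Set.range φ).Finite := by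
  -- `φ` is constant on right cosets of `K`; inversion turns these into the left cosets forming `Δ ⧸
  -- K`.
  refine (Set.finite_range fun x : Δ ⧸ K => φ x.out⁻¹).subset ?_
  rintro _ ⟨δ, rfl⟩
  obtain ⟨k, hk⟩ := QuotientGroup.mk_out_eq_mul K δ⁻¹
  refine ⟨(δ⁻¹ : Δ), ?_⟩
  simp only [hk, mul_inv_rev, inv_inv]
  exact h _ (inv_mem k.2) δ

theorem exists_subset_of_monotone {Δ : ℕ → Subgroup Γ} (hm : Monotone Δ)
    (hu : ∀ γ, ∃ n, γ ∈ Δ n) {S : Set Γ} (hS : S.Finite) : ∃ n, S ⊆ Δ n := by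
  choose N hN using hu
  refine ⟨hS.toFinset.sup N, fun γ hγ => hm (Finset.le_sup ?_) (hN γ)⟩
  exact hS.mem_toFinset.2 hγ

theorem Group.FG.exists_range_le (hL : Group.FG L) {Δ : ℕ → Subgroup Γ} (hm : Monotone Δ)
    (hu : ∀ γ, ∃ n, γ ∈ Δ n) (f : L →* Γ) : ∃ n, ∀ l, f l ∈ Δ n := by
  obtain ⟨S, hS⟩ := Group.fg_def.1 hL
  obtain ⟨n, hn⟩ := exists_subset_of_monotone hm hu (S.finite_toSet.image f)
  refine ⟨n, fun l => ?_⟩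
  have : Subgroup.closure (S : Set L) ≤ (Δ n).comap f :=
    (Subgroup.closure_le _).2 fun s hs => hn ⟨s, hs, rfl⟩
  exact this (hS ▸ Subgroup.mem_top l)

variable [Countable Γ]

/-- The representations for which a given finitely generated subgroup has finite orbits on a given
finite set, and which have a global fixed point, are dense. -/
theorem exists_finite_orbits (hΓ : IsIncreasingUnionRZ Γ) (hL : Group.FG L) (f : L →* Γ)
    (π : Γ →* UrysohnGroup) {t : Set (Γ × RationalUrysohn)} (ht : t.Finite)
    (u₀ : RationalUrysohn) :
    ∃ σ : Γ →* UrysohnGroup, (∀ z ∈ t, σ z.1 z.2 = π z.1 z.2) ∧ (∃ u, ∀ γ, σ γ u = u) ∧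
      (Set.range fun l => σ (f l) u₀).Finite := by
  classical
  obtain ⟨Δ', hm, -, hRZ, hu⟩ := hΓ
  obtain ⟨n, hn⟩ := exists_subset_of_monotone hm hu (ht.image Prod.fst)
  obtain ⟨m, hm'⟩ := hL.exists_range_le hm hu f
  -- One group with (RZ) has to contain both the group elements of `t` and the image of `f`.
  obtain ⟨Δ, hΔ, htΔ, hfΔ⟩ : ∃ Δ : Subgroup Γ, HasRZ Δ ∧ (∀ z ∈ t, z.1 ∈ Δ) ∧ ∀ l, f l ∈ Δ :=
    ⟨Δ' (max n m), hRZ _, fun z hz => hm (le_max_left n m) (hn ⟨z, hz, rfl⟩),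
      fun l => hm (le_max_right n m) (hm' l)⟩
  let _ : MulAction Δ RationalUrysohn :=
    { smul := fun δ u => π δ u
      one_smul := fun u => by change π 1 u = u; rw [map_one]; rfl
      mul_smul := fun δ δ' u => by change π (δ * δ') u = π δ (π δ' u); rw [map_mul]; rfl }
  have hFf : {δ : Δ | ∃ z ∈ t, z.1 = δ}.Finite :=
    ((ht.image Prod.fst).preimage Subtype.val_injective.injOn).subset
      fun δ ⟨z, hz, h⟩ => ⟨z, hz, h⟩
  let B : Finset RationalUrysohn :=
    insert u₀ (ht.toFinset.image Prod.snd ∪ ht.toFinset.image fun z => π z.1 z.2)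
  have hB0 : u₀ ∈ B := Finset.mem_insert_self _ _
  have hB1 : ∀ z ∈ t, z.2 ∈ B := fun z hz => Finset.mem_insert_of_mem
    (Finset.mem_union_left _ (Finset.mem_image.2 ⟨z, ht.mem_toFinset.2 hz, rfl⟩))
  have hB2 : ∀ z ∈ t, π z.1 z.2 ∈ B := fun z hz => Finset.mem_insert_of_mem
    (Finset.mem_union_right _ (Finset.mem_image.2 ⟨z, ht.mem_toFinset.2 hz, rfl⟩))
  obtain ⟨K, dW, C, hK, hW, hWinv, hWC, hWK, hW1, hWF⟩ := hΔ.exists_finite_approximation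
    isRatPseudometric_rdist (fun _ _ => eq_of_rdist) (fun δ u v => rdist_map (π δ) u v) B
    hFf.toFinset
  let _ : MulAction Γ Unit :=
    { smul := fun _ u => u
      one_smul := fun _ => rfl
      mul_smul := fun _ _ _ => rfl }
  have hC : 0 ≤ max C 0 := le_max_right _ _
  -- The approximating `Δ`-space is induced up to `Γ` and amalgamated with a fixed point at constant
  -- distance `max C 0`, which is allowed since `dW` is bounded by `C`.
  obtain ⟨D, hD, hDinv, -, hD1, hD2, -⟩ := exists_amalgam (I := Unit) (B := Unit) Δ.subtype
    Δ.subtype_injective (dB := fun _ _ => 0) ⟨fun _ => rfl, fun _ _ => rfl, fun _ _ _ => by simp⟩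
    (fun _ _ _ => rfl) hW hWinv id (fun _ _ => max C 0) (fun _ _ _ => by simp)
    (fun _ _ _ => by linarith) (fun v w _ => by linarith [hW.nonneg v w])
    (fun v w _ => by linarith [hWC v w, le_max_left C 0])
    (fun _ _ => ⟨(), rfl, fun _ => rfl⟩)
  obtain ⟨σ, j, hj1, hj2, hj3⟩ := exists_equivariant_embedding hD hDinv
    (p := Set.range fun b : B => (Sum.inr ⟨1, ⟨1, b⟩⟩, b.1)) (Set.finite_range _) (by
      rintro _ ⟨b, rfl⟩ _ ⟨b', rfl⟩
      exact (hD1 _ _).trans (hW1 b b'))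
  have hj4 : ∀ b : B, j (.inr ⟨1, ⟨1, b⟩⟩) = b := fun b => hj3 _ ⟨b, rfl⟩
  have hj5 : ∀ v w, dW v w = 0 → j (.inr ⟨1, v⟩) = j (.inr ⟨1, w⟩) := fun v w h =>
    eq_of_rdist (by rw [hj1, hD1, h])
  have hσ : ∀ (δ : Δ) (b : B), σ δ b = j (.inr ⟨1, ⟨δ, b⟩⟩) := by
    intro δ b
    rw [← hj4 b, ← hj2]
    refine eq_of_rdist ?_
    rw [hj1]
    have := hD2 δ ⟨1, b⟩
    rw [Copies.smul_mk, mul_one] at this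
    rw [← this]
    change D (.inr ⟨δ * 1, _⟩) _ = _
    rw [mul_one]
    rfl
  refine ⟨σ, fun z hz => ?_, ⟨j (.inl ()), fun γ => (hj2 γ (.inl ())).symm⟩, ?_⟩
  · have h1 := hσ ⟨z.1, htΔ z hz⟩ ⟨z.2, hB1 z hz⟩
    have h2 := hWF ⟨z.1, htΔ z hz⟩ (hFf.mem_toFinset.2 ⟨z, hz, rfl⟩) ⟨z.2, hB1 z hz⟩
      ⟨π z.1 z.2, hB2 z hz⟩ rfl
    exact h1.trans ((hj5 _ _ h2).trans (hj4 _))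
  · refine (finite_range_of_finiteIndex K (fun δ : Δ => σ δ u₀) fun k hk δ => ?_).subset ?_
    · refine (hσ (k * δ) ⟨u₀, hB0⟩).trans (Eq.trans ?_ (hσ δ ⟨u₀, hB0⟩).symm)
      exact hj5 _ _ (hWK k hk ⟨δ, ⟨u₀, hB0⟩⟩)
    · rintro _ ⟨l, rfl⟩
      exact ⟨⟨f l, hfΔ l⟩, rfl⟩

/-- Any representation can be modified, away from a finite set, so as to realise an extension of a
finite invariant subspace. -/
theorem exists_realize_extension (f : L →* Γ) (hf : Function.Injective f)
    (π : Γ →* UrysohnGroup) {t : Set (Γ × RationalUrysohn)} (ht : t.Finite) {n : ℕ}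
    (a : L →* Equiv.Perm (Fin n)) {d : Fin n → Fin n → ℚ} {q : Finset (Fin n × RationalUrysohn)}
    (hd : IsRatPseudometric d) (hinv : ∀ l i j, d (a l i) (a l j) = d i j) (hq : q.Nonempty)
    (hqd : IsIsometricRel d rdist (q : Set (Fin n × RationalUrysohn)))
    (hqa : ∀ l, ∀ z ∈ q, (a l z.1, π (f l) z.2) ∈ q) :
    ∃ σ : Γ →* UrysohnGroup, (∀ z ∈ t, σ z.1 z.2 = π z.1 z.2) ∧
      ∃ ψ : Fin n → RationalUrysohn, (∀ i j, rdist (ψ i) (ψ j) = d i j) ∧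
        (∀ l i, ψ (a l i) = σ (f l) (ψ i)) ∧ ∀ z ∈ q, ψ z.1 = z.2 := by
  classical
  let _ : MulAction Γ RationalUrysohn :=
    { smul := fun γ u => π γ u
      one_smul := fun u => by change π 1 u = u; rw [map_one]; rfl
      mul_smul := fun δ δ' u => by change π (δ * δ') u = π δ (π δ' u); rw [map_mul]; rfl }
  let _ : MulAction L (Fin n) := MulAction.compHom _ a
  have : Nonempty q := hq.to_subtype
  have hqd' : ∀ i j : q, rdist i.1.2 j.1.2 = d i.1.1 j.1.1 := fun i j =>
    (hqd i.1 i.2 j.1 j.2).symm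
  obtain ⟨D, hD, hDinv, hD0, hD1, hD2, hD3⟩ := exists_amalgam (I := q) f hf
    isRatPseudometric_rdist (fun γ u v => rdist_map (π γ) u v) hd (fun l i j => hinv l i j)
    (fun i => i.1.2) (fun y i => d y i.1.1)
    (fun y i j => by rw [hqd', hd.symm i.1.1]; exact hd.tri _ _ _)
    (fun y i j => by rw [hqd', hd.symm y i.1.1]; exact hd.tri _ _ _)
    (fun y y' i => hd.tri _ _ _)
    (fun y y' i => by rw [hd.symm y' i.1.1]; exact hd.tri _ _ _)
    (fun l i => ⟨⟨_, hqa l i.1 i.2⟩, rfl, fun y => hinv l y i.1.1⟩)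
  -- Fixing both `z.2` and `π z.1 z.2` under the embedding forces `σ` to agree with `π` at `z`.
  let S : Set RationalUrysohn :=
    (Prod.snd '' t ∪ (fun z => π z.1 z.2) '' t) ∪ Prod.snd '' (q : Set (Fin n × RationalUrysohn))
  obtain ⟨σ, j, hj1, hj2, hj3⟩ := exists_equivariant_embedding hD hDinv
    (p := (fun u => (Sum.inl u, u)) '' S)
    (((ht.image _).union (ht.image _)).union (q.finite_toSet.image _) |>.image _) (by
      rintro _ ⟨u, -, rfl⟩ _ ⟨v, -, rfl⟩
      exact hD0 _ _)
  have hj4 : ∀ u ∈ S, j (.inl u) = u := fun u hu => hj3 _ ⟨u, hu, rfl⟩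
  refine ⟨σ, fun z hz => ?_, fun i => j (.inr ⟨1, i⟩), fun i k => ?_, fun l i => ?_,
    fun z hz => ?_⟩
  · rw [← hj4 z.2 (Or.inl (Or.inl ⟨z, hz, rfl⟩)), ← hj2]
    exact (hj4 _ (Or.inl (Or.inr ⟨z, hz, rfl⟩))).trans
      (congrArg _ (hj4 z.2 (Or.inl (Or.inl ⟨z, hz, rfl⟩))).symm)
  · rw [hj1, hD1]
  · rw [← hj2]
    refine (eq_of_rdist ?_).symm
    rw [hj1]
    refine Eq.trans ?_ (hD2 l i)
    change D (.inr ⟨f l * 1, i⟩) _ = _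
    rw [mul_one]
    rfl
  · rw [← hj4 z.2 (Or.inr ⟨z, hz, rfl⟩)]
    refine eq_of_rdist ?_
    rw [hj1]
    exact (hD3 z.1 ⟨z, hz⟩).trans (hd.self _)

theorem eventually_isUniversalAction (hΓ : IsIncreasingUnionRZ Γ) (hL : Group.FG L) (f : L →* Γ)
    (hf : Function.Injective f) :
    ∀ᶠ π in @residual (Γ →* UrysohnGroup) (repTopology Γ UrysohnGroup),
      IsUniversalAction (π.comp f) := by
  let _ := repTopology Γ UrysohnGroup
  have h1 : ∀ᶠ π in residual (Γ →* UrysohnGroup), ∃ u, ∀ l, π (f l) u = u := by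
    refine mem_residual_repTopology (isOpen_iff_mem_nhds.2 ?_) fun π t ht => ?_
    · rintro π ⟨u, hu⟩
      refine Filter.mem_of_superset ((isOpen_setOf_equivariant hL f (n := 1) 1
        fun _ => u).mem_nhds fun l _ => (hu l).symm) fun σ hσ => ⟨u, fun l => (hσ l 0).symm⟩
    · obtain ⟨σ, h1, ⟨u, hu⟩, -⟩ :=
        exists_finite_orbits hΓ hL f π ht (Classical.arbitrary RationalUrysohn)
      exact ⟨σ, ⟨u, fun l => hu _⟩, h1⟩
  have h2 : ∀ᶠ π in residual (Γ →* UrysohnGroup), ∀ u, (Set.range fun l => π (f l) u).Finite := by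
    refine eventually_countable_forall.2 fun u => ?_
    refine mem_residual_repTopology (isOpen_iff_mem_nhds.2 fun π hπ => ?_) fun π t ht => ?_
    -- Nearby representations act on the finite orbit of `u` by the same permutations.
    · obtain ⟨n, a, ψ, -, hr, heq⟩ := exists_fin_model (π.comp f) hπ (by
        rintro l _ ⟨l', rfl⟩
        exact ⟨l * l', by simp only [map_mul]; rfl⟩)
      obtain ⟨i, rfl⟩ : u ∈ Set.range ψ := by
        rw [hr]
        exact ⟨1, by simp only [map_one]; rfl⟩
      refine Filter.mem_of_superset ((isOpen_setOf_equivariant hL f a ψ).mem_nhds heq)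
        fun σ hσ => (Set.finite_range ψ).subset ?_
      rintro _ ⟨l, rfl⟩
      exact ⟨a l i, hσ l i⟩
    · obtain ⟨σ, h1, -, h2⟩ := exists_finite_orbits hΓ hL f π ht u
      exact ⟨σ, h2, h1⟩
  have h3 : ∀ᶠ π in residual (Γ →* UrysohnGroup), ∀ (n : ℕ) (a : L →* Equiv.Perm (Fin n))
      (d : Fin n → Fin n → ℚ) (q : Finset (Fin n × RationalUrysohn)), IsRatPseudometric d →
      (∀ l i j, d (a l i) (a l j) = d i j) → q.Nonempty → IsIsometricRel d rdist (q : Set _) →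
      (∀ l, ∀ z ∈ q, (a l z.1, π (f l) z.2) ∈ q) →
      ∃ ψ : Fin n → RationalUrysohn, (∀ i j, rdist (ψ i) (ψ j) = d i j) ∧
        (∀ l i, ψ (a l i) = π (f l) (ψ i)) ∧ ∀ z ∈ q, ψ z.1 = z.2 := by
    refine eventually_countable_forall.2 fun n => ?_
    have := hL.countable_hom_of_finite (Equiv.Perm (Fin n))
    refine eventually_countable_forall.2 fun a => eventually_countable_forall.2 fun d =>
      eventually_countable_forall.2 fun q => ?_
    simp only [Filter.eventually_imp_distrib_left]
    intro hd hinv hq hqd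
    refine mem_residual_repTopology (isOpen_iff_mem_nhds.2 fun π hπ => ?_) fun π t ht => ?_
    -- The condition is an implication. If `q` is invariant, the witness `ψ` persists nearby; if
    -- not, one value of `π` shows it, and the implication stays vacuous nearby.
    · by_cases hqa : ∀ l, ∀ z ∈ q, (a l z.1, π (f l) z.2) ∈ q
      · obtain ⟨ψ, h1, h2, h3⟩ := hπ hqa
        exact Filter.mem_of_superset ((isOpen_setOf_equivariant hL f a ψ).mem_nhds h2)
          fun σ hσ _ => ⟨ψ, h1, hσ, h3⟩
      · push Not at hqa
        obtain ⟨l, z, hz, hl⟩ := hqa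
        refine mem_nhds_repTopology.2 ⟨{(f l, z.2)}, Set.finite_singleton _, fun σ hσ h => ?_⟩
        have := h l z hz
        rw [hσ (f l, z.2) rfl] at this
        exact absurd this hl
    · by_cases hqa : ∀ l, ∀ z ∈ q, (a l z.1, π (f l) z.2) ∈ q
      · obtain ⟨σ, h1, h2⟩ := exists_realize_extension f hf π ht a hd hinv hq hqd hqa
        exact ⟨σ, fun _ => h2, h1⟩
      · exact ⟨π, fun h => absurd h hqa, fun _ _ => rfl⟩
  filter_upwards [h1, h2, h3] with π h1 h2 h3
  exact ⟨h1, h2, h3⟩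

end Residual

/-! ### Property (RZ) for subgroups, for ℤ and for the exhaustion of ℚ. -/

section RZ

/-- Images of products of finitely generated subgroups are again such products, and finite index
normal subgroups pull back to such; injectivity recovers a set from its image. -/
theorem HasRZ.of_injective {A B : Type*} [Group A] [Group B] (hB : HasRZ B) (f : A →* B)
    (hf : Function.Injective f) : HasRZ A := by
  refine hasRZ_iff.2 fun L hL => ?_
  have himg : ∀ L : List (Subgroup A), f '' (L.map fun H : Subgroup A => (H : Set A)).prod =
      ((L.map fun H : Subgroup A => H.map f).map fun H : Subgroup B => (H : Set B)).prod := by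
    intro L
    induction L with
    | nil => simp [Set.singleton_one]
    | cons H L ih => simp only [List.map_cons, List.prod_cons, Set.image_mul, ih, Subgroup.coe_map]
  have hcl := hasRZ_iff.1 hB (L.map fun H : Subgroup A => H.map f) (by
    intro K hK
    obtain ⟨H, hH, rfl⟩ := List.mem_map.1 hK
    exact (Subgroup.fg_iff_submonoid_fg _).2
      (((Subgroup.fg_iff_submonoid_fg H).1 (hL H hH)).map f))
  rw [← himg, isClosed_profiniteTopology_iff] at hcl
  refine isClosed_profiniteTopology_iff.2 fun a ha => ?_
  obtain ⟨K, hn, hfi, hK⟩ := hcl (f a) fun ⟨b, hb, h⟩ => ha (hf h ▸ hb)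
  refine ⟨K.comap f, inferInstance, ⟨?_⟩, fun k hk h =>
    hK (f k) hk ⟨a * k, h, map_mul f a k⟩⟩
  rw [Subgroup.index_comap]
  exact (inferInstance : (K.subgroupOf f.range).FiniteIndex).index_ne_zero

theorem HasRZ.isIncreasingUnionRZ {Γ : Type*} [Group Γ] [Countable Γ] (h : HasRZ Γ) :
    IsIncreasingUnionRZ Γ := by
  obtain ⟨e, he⟩ := exists_surjective_nat Γ
  refine ⟨fun n => Subgroup.closure (e '' Set.Iio n), fun m n hmn => ?_, fun n => ?_, fun n => ?_,
    fun γ => ?_⟩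
  · exact Subgroup.closure_mono (Set.image_mono (Set.Iio_subset_Iio hmn))
  · exact ⟨((Set.finite_Iio n).image e).toFinset, by simp⟩
  · exact h.of_injective _ (Subgroup.subtype_injective _)
  · obtain ⟨n, rfl⟩ := he γ
    exact ⟨n + 1, Subgroup.subset_closure ⟨n, Nat.lt_succ_self n, rfl⟩⟩

theorem exists_subgroup_eq_prod {A : Type*} [CommGroup A] (L : List (Subgroup A)) :
    ∃ H : Subgroup A, (L.map fun H : Subgroup A => (H : Set A)).prod = H := by
  induction L with
  | nil => exact ⟨⊥, by simp [Set.singleton_one]⟩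
  | cons H L ih =>
    obtain ⟨K, hK⟩ := ih
    exact ⟨H ⊔ K, by rw [List.map_cons, List.prod_cons, hK, Subgroup.mul_normal]⟩

theorem hasRZ_multiplicative_int : HasRZ (Multiplicative ℤ) := by
  refine hasRZ_iff.2 fun L _ => ?_
  obtain ⟨H, hH⟩ := exists_subgroup_eq_prod L
  rw [hH]
  refine isClosed_profiniteTopology_iff.2 fun x hx => ?_
  obtain ⟨m, hm, hmH⟩ : ∃ m : ℤ, m ≠ 0 ∧
      ∀ c : ℤ, x * Multiplicative.ofAdd (m * c) ∉ H := by
    -- A nontrivial `h` in `H` serves as the modulus. If `H` is trivial, `2x` does, since `x (1 +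
    -- 2c)` is nonzero by parity.
    by_cases hbot : ∃ h ∈ H, h ≠ 1
    · obtain ⟨h, hhH, h1⟩ := hbot
      refine ⟨h.toAdd, h1, fun c hc => hx ?_⟩
      have hc' : Multiplicative.ofAdd (h.toAdd * c) = h ^ c := by
        rw [mul_comm, ← smul_eq_mul, ofAdd_zsmul, ofAdd_toAdd]
      rw [hc'] at hc
      exact (H.mul_mem_cancel_right (H.zpow_mem hhH c)).1 hc
    · push Not at hbot
      have hx1 : x ≠ 1 := fun h => hx (h ▸ H.one_mem)
      have hx0 : x.toAdd ≠ 0 := hx1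
      refine ⟨2 * x.toAdd, by simpa using hx0, fun c hc => ?_⟩
      have h1 : x.toAdd + 2 * x.toAdd * c = 0 := hbot _ hc
      have h2 : x.toAdd * (1 + 2 * c) = 0 := by linarith
      rcases mul_eq_zero.1 h2 with h | h
      · exact hx0 h
      · omega
  have : NeZero m.natAbs := ⟨Int.natAbs_ne_zero.2 hm⟩
  let φ : Multiplicative ℤ →* Multiplicative (ZMod m.natAbs) :=
    AddMonoidHom.toMultiplicative (Int.castAddHom (ZMod m.natAbs))
  have : Finite (Multiplicative (ZMod m.natAbs)) := inferInstanceAs (Finite (ZMod m.natAbs))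
  refine ⟨φ.ker, inferInstance, inferInstance, fun k hk => ?_⟩
  have hk' : ((k.toAdd : ℤ) : ZMod m.natAbs) = 0 := hk
  rw [ZMod.intCast_zmod_eq_zero_iff_dvd, Int.natAbs_dvd] at hk'
  obtain ⟨c, hc⟩ := hk'
  have := hmH c
  rwa [← hc, ofAdd_toAdd] at this

open Nat in
theorem isIncreasingUnionRZ_rat : IsIncreasingUnionRZ (Multiplicative ℚ) := by
  refine ⟨fun n => Subgroup.zpowers (Multiplicative.ofAdd ((n ! : ℚ)⁻¹)),
    monotone_nat_of_le_succ fun n => ?_, fun n => ?_, fun n => ?_, fun γ => ?_⟩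
  · rw [Subgroup.zpowers_le]
    refine Subgroup.mem_zpowers_iff.2 ⟨(n + 1 : ℕ), ?_⟩
    rw [← ofAdd_zsmul]
    congr 1
    have : ((n + 1 : ℕ) : ℚ) ≠ 0 := by positivity
    rw [Nat.factorial_succ, Nat.cast_mul, mul_inv, zsmul_eq_mul, Int.cast_natCast,
      mul_inv_cancel_left₀ this]
  · exact ⟨{Multiplicative.ofAdd ((n ! : ℚ)⁻¹)}, by
      simp only [Finset.coe_singleton, Subgroup.zpowers_eq_closure]⟩
  · let θ := zpowersHom (Multiplicative ℚ) (Multiplicative.ofAdd ((n ! : ℚ)⁻¹))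
    have hθ : Function.Injective θ := by
      refine (injective_iff_map_eq_one θ).2 fun k hk => ?_
      have h1 : ((k.toAdd : ℤ) : ℚ) * (n ! : ℚ)⁻¹ = 0 := by
        rw [← zsmul_eq_mul]
        exact hk
      have h2 : (n ! : ℚ)⁻¹ ≠ 0 := by positivity
      exact Int.cast_eq_zero.1 ((mul_eq_zero.1 h1).resolve_right h2)
    exact hasRZ_multiplicative_int.of_injective (MonoidHom.ofInjective hθ).symm.toMonoidHom
      (MonoidHom.ofInjective hθ).symm.injective
  -- With `γ = p / q`, one has `p / q = p (q - 1)! / q!`.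
  · refine ⟨γ.toAdd.den, Subgroup.mem_zpowers_iff.2
      ⟨γ.toAdd.num * (γ.toAdd.den - 1)!, ?_⟩⟩
    rw [← ofAdd_zsmul, ← ofAdd_toAdd γ]
    congr 1
    have h1 : (((γ.toAdd.den - 1)! : ℕ) : ℚ) ≠ 0 := by positivity
    have h2 : ((γ.toAdd.den : ℕ) : ℚ) ≠ 0 := by exact_mod_cast γ.toAdd.den_ne_zero
    simp only [toAdd_ofAdd, zsmul_eq_mul]
    rw [← Nat.mul_factorial_pred γ.toAdd.den_ne_zero]
    conv_rhs => rw [← Rat.num_div_den γ.toAdd]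
    push_cast
    field_simp

end RZ

/-! ### Genericity on all finitely generated subgroups. -/

/-- With `f` the identity, the universal actions are comeagre, and all of them are conjugate to `π`.
-/
theorem isGeneric_of_isUniversalAction {L : Type*} [Group L] [Countable L]
    (hL : IsIncreasingUnionRZ L) (hfg : Group.FG L) {π : L →* UrysohnGroup}
    (hπ : IsUniversalAction π) : IsGeneric π := by
  refine Filter.mem_of_superset
    (eventually_isUniversalAction hL hfg (MonoidHom.id L) Function.injective_id) fun σ hσ => ?_
  exact hπ.mem_conjOrbit hσ

theorem mainTheorem2 (Γ : Type*) [Group Γ] [Countable Γ] :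
    (IsIncreasingUnionRZ Γ →
      ∃ π : Γ →* (RationalUrysohn ≃ᵢ RationalUrysohn),
        ∀ Λ : Subgroup Γ, Λ.FG → IsGeneric (π.comp Λ.subtype)) ∧
    (HasRZ Γ → IsIncreasingUnionRZ Γ) ∧
    IsIncreasingUnionRZ (Multiplicative ℚ) := by
  refine ⟨fun hΓ => ?_, HasRZ.isIncreasingUnionRZ, isIncreasingUnionRZ_rat⟩
  let _ := repTopology Γ UrysohnGroup
  have hfg : ∀ S : Finset Γ, Group.FG (Subgroup.closure (S : Set Γ)) := fun S =>
    (Group.fg_iff_subgroup_fg _).2 ⟨S, rfl⟩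
  have h : ∀ᶠ π in residual (Γ →* UrysohnGroup), ∀ S : Finset Γ,
      IsUniversalAction (π.comp (Subgroup.closure (S : Set Γ)).subtype) :=
    eventually_countable_forall.2 fun S =>
      eventually_isUniversalAction hΓ (hfg S) _ (Subgroup.subtype_injective _)
  have := baireSpace_repTopology (Γ := Γ)
  obtain ⟨π, hπ⟩ := (dense_of_mem_residual h).nonempty
  refine ⟨π, ?_⟩
  rintro _ ⟨S, rfl⟩
  -- Genericity refers to representations of the subgroup alone, so the subgroup must itself satisfy
  -- the hypothesis; it inherits (RZ) from some `Δ n`.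
  obtain ⟨Δ, hm, -, hRZ, hu⟩ := hΓ
  obtain ⟨n, hn⟩ := (hfg S).exists_range_le hm hu (Subgroup.closure (S : Set Γ)).subtype
  have hle : Subgroup.closure (S : Set Γ) ≤ Δ n := fun γ hγ => hn ⟨γ, hγ⟩
  exact isGeneric_of_isUniversalAction
    ((hRZ n).of_injective _ (Subgroup.inclusion_injective hle)).isIncreasingUnionRZ (hfg S) (hπ S)
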